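/- An instance of Edge-Disjoint Paths (EDP) consists of a finite simple undirected graph $G$ and a list of $k$ pairs $(s_1,t_1),\dots,(s_k,t_k)$ of distinct vertices of $G$, repetitions allowed; it is a Yes-instance if $G$ contains pairwise edge-disjoint paths $P_1,\dots,P_k$ such that $P_i$ connects $s_i$ and $t_i$ for every $i$. A graph is a split graph if its vertex set can be partitioned into a clique and an independent set. Theorem. EDP on split graphs, parameterized by $k$, has a kernel with $\mathcal{O}(k^{2.75})$ vertices. That is, there are a constant $C$ and a polynomial-time algorithm that transforms every instance of EDP with $k$ terminal pairs on a split graph $G$ into an instance of EDP with $k'\le k$ terminal pairs on a split graph $G'$ such that the two instances are equivalent (one is a Yes-instance if and only if the other is) and $|V(G')|\le C\cdot\max(k,1)^{2.75}$. Moreover, $G'$ is connected whenever $G$ is connected. -/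

import Mathlib

/-!
Edge-disjoint paths on split graphs, and a step-counting random access machine
on which kernelization algorithms are run.
-/

namespace EDP

/-! ### The problem -/

/-- An instance of Edge-Disjoint Paths: a finite simple undirected graph, with vertices numbered
`0, …, n - 1`, and an ordered multiset (a list, so repetitions are allowed and counted) of
terminal pairs, each consisting of two distinct vertices. -/
structure Instance where
  /-- the number of vertices -/
  n : ℕ
  /-- the graph -/
  graph : SimpleGraph (Fin n)
  /-- the terminal pairs -/
  pairs : List (Fin n × Fin n)
  /-- the two vertices of a terminal pair are distinct -/
  ne_of_mem : ∀ p ∈ pairs, p.1 ≠ p.2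

namespace Instance

/-- The parameter `k`: the number of occurrences of terminal pairs. -/
def k (x : Instance) : ℕ := x.pairs.length

/-- Yes-instances: there are pairwise edge-disjoint paths `P₁, …, P_k` such that `Pᵢ` connects the
two vertices of the `i`-th terminal pair. -/
def IsYes (x : Instance) : Prop :=
  ∃ P : (i : Fin x.pairs.length) → x.graph.Path (x.pairs.get i).1 (x.pairs.get i).2,
    ∀ i j, i ≠ j → List.Disjoint (P i).1.edges (P j).1.edges

/-- The graph is a split graph: its vertex set is partitioned into a clique and an
independent set. -/
def IsSplit (x : Instance) : Prop :=
  ∃ C : Set (Fin x.n), x.graph.IsClique C ∧ x.graph.IsIndepSet Cᶜ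

open Classical in
/-- The encoding of an instance as a list of numbers: `n`, `k`, the adjacency matrix row by row,
and the terminal pairs in their order. It has `2 + n ^ 2 + 2 * k` entries, each of them at most
`max (max n k) 1`, and it can be decoded uniquely. -/
noncomputable def encode (x : Instance) : List ℕ :=
  [x.n, x.k]
    ++ (List.finRange x.n).flatMap
        (fun i => (List.finRange x.n).map fun j => if x.graph.Adj i j then 1 else 0)
    ++ x.pairs.flatMap (fun p => [(p.1 : ℕ), (p.2 : ℕ)])

end Instance

/-! ### The machine model

Structured programs for a random access machine. The machine has registers and arrays of natural
numbers. The only arithmetic operations are addition and truncated subtraction, so that in `t`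
steps a program only produces numbers with `O(t)` more bits than the input, and polynomial time on
this machine is polynomial time in the usual sense. -/

/-- Memory contents. -/
structure Memory where
  /-- the registers -/
  reg : ℕ → ℕ
  /-- `arr a i` is the content of cell `i` of array `a` -/
  arr : ℕ → ℕ → ℕ

/-- Arithmetic expressions. -/
inductive Expr where
  | const (c : ℕ)
  | reg (r : ℕ)
  | cell (a : ℕ) (i : Expr)
  | add (e₁ e₂ : Expr)
  | sub (e₁ e₂ : Expr)

/-- The value of an expression. -/
def Expr.eval (m : Memory) : Expr → ℕ
  | .const c => c
  | .reg r => m.reg r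
  | .cell a i => m.arr a (i.eval m)
  | .add e₁ e₂ => e₁.eval m + e₂.eval m
  | .sub e₁ e₂ => e₁.eval m - e₂.eval m

/-- Programs. -/
inductive Program where
  | skip
  /-- write the value of `e` to register `r` -/
  | assign (r : ℕ) (e : Expr)
  /-- write the value of `e` to the cell of array `a` whose index is the value of `i` -/
  | store (a : ℕ) (i e : Expr)
  | seq (p q : Program)
  /-- run `p` if the value of `e` is nonzero, and `q` otherwise -/
  | ite (e : Expr) (p q : Program)
  /-- run `p` as long as the value of `e` is nonzero -/
  | loop (e : Expr) (p : Program)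

/-- `Exec p m m' t`: started on memory `m`, the program `p` halts with memory `m'` after `t` steps.
A step is the execution of one instruction or of one test; it evaluates at most two expressions
that are written in the program, hence it takes a number of elementary operations that
depends only on the program. -/
inductive Exec : Program → Memory → Memory → ℕ → Prop
  | skip (m : Memory) : Exec .skip m m 1
  | assign (r : ℕ) (e : Expr) (m : Memory) :
      Exec (.assign r e) m ⟨Function.update m.reg r (e.eval m), m.arr⟩ 1
  | store (a : ℕ) (i e : Expr) (m : Memory) :
      Exec (.store a i e) m
        ⟨m.reg, Function.update m.arr a (Function.update (m.arr a) (i.eval m) (e.eval m))⟩ 1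
  | seq {p q : Program} {m₁ m₂ m₃ : Memory} {t₁ t₂ : ℕ}
      (hp : Exec p m₁ m₂ t₁) (hq : Exec q m₂ m₃ t₂) : Exec (.seq p q) m₁ m₃ (t₁ + t₂)
  | ite_true {e : Expr} {p q : Program} {m m' : Memory} {t : ℕ}
      (he : e.eval m ≠ 0) (hp : Exec p m m' t) : Exec (.ite e p q) m m' (t + 1)
  | ite_false {e : Expr} {p q : Program} {m m' : Memory} {t : ℕ}
      (he : e.eval m = 0) (hq : Exec q m m' t) : Exec (.ite e p q) m m' (t + 1)
  | loop_true {e : Expr} {p : Program} {m₁ m₂ m₃ : Memory} {t₁ t₂ : ℕ}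
      (he : e.eval m₁ ≠ 0) (hp : Exec p m₁ m₂ t₁) (hl : Exec (.loop e p) m₂ m₃ t₂) :
      Exec (.loop e p) m₁ m₃ (t₁ + t₂ + 1)
  | loop_false {e : Expr} {p : Program} {m : Memory}
      (he : e.eval m = 0) : Exec (.loop e p) m m 1

/-- The initial memory: the input list is in array `0`, everything else is `0`. -/
def inputMemory (l : List ℕ) : Memory :=
  ⟨fun _ => 0, fun a i => if a = 0 then l.getD i 0 else 0⟩

/-- Array `1` begins with the list `l`. -/
def HasOutput (m : Memory) (l : List ℕ) : Prop :=
  ∀ (i : ℕ) (h : i < l.length), m.arr 1 i = l[i]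

/-- On input `x`, the program `p` halts after at most `T` steps and has then written (the encoding
of) the instance `y`. -/
def TransformsWithin (p : Program) (x y : Instance) (T : ℕ) : Prop :=
  ∃ (m : Memory) (t : ℕ), Exec p (inputMemory x.encode) m t ∧ t ≤ T ∧ HasOutput m y.encode

/-- The program `p` is a kernelization algorithm for Edge-Disjoint Paths on split graphs with
at most `f k` vertices: in time polynomial in the size of the input, it transforms each instance
`x` on a split graph into an equivalent instance `y` on a split graph with at most `f k` vertices,
where `k` is the parameter of `x`, and whose parameter is at most `k`. Connected graphs are
transformed into connected graphs, so that `p` is also a kernelization algorithm for the problem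
restricted to connected split graphs. -/
def IsSplitKernelization (p : Program) (f : ℕ → ℝ) : Prop :=
  ∃ time : Polynomial ℕ, ∀ x : Instance, x.IsSplit →
    ∃ y : Instance, TransformsWithin p x y (time.eval x.encode.length) ∧
      y.IsSplit ∧ (x.graph.Connected → y.graph.Connected) ∧
      (x.IsYes ↔ y.IsYes) ∧ y.k ≤ x.k ∧ (y.n : ℝ) ≤ f x.k

end EDP

/-!
Why the kernel exists. Let `C` be the clique and `I` the independent set of a partition of the
split graph `G`, and let `k` be the number of terminal pairs.

If `C` has at least `4 * k` vertices, the instance is a Yes-instance as soon as no vertex occurs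
in more terminal pairs than it has neighbours: every terminal in `I` moves to the clique along
edges of its own, and in the clique the pairs are connected through distinct middle vertices
(`Instance.isYes_of_occ_le_deg`). The condition is also necessary (`Instance.IsYes.occ_le_deg`),
so the algorithm writes a trivial instance. The two cases are told apart by the number of vertices
of degree at least `4 * k`, without computing the partition.

Otherwise `C` has at most `4 * k` vertices. In a routing of minimum total length each path has
length `O(√k)` (`IsShortest.length_le_of_isClique`): a chord of a path `P` that joins two vertices
of `C` must be used by another path `P'`, and exchanging the chord and the skipped segment of `P`
shows that `P'` avoids the vertices that the chord skips. Hence the quadratically many chords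
between the first and the second half of `P` lie on different paths. So all paths together touch
only `O(k ^ 1.5)` vertices.

The algorithm constructs `f = 10 * k * (Nat.sqrt k + 1)` disjoint layers one after the other. A
vertex that is not yet kept is put into the current layer if its neighbours are not yet all linked
through this layer. A vertex of a layer outside `C` decreases the number of classes of linked
vertices of `C`, so a layer has at most `C.card` such vertices, and `O(k ^ 2.5)` vertices are kept
in total. The neighbours of a vertex `v` that is not kept are linked through every layer. As `f`
is large enough, each path of a shortest routing has a layer of its own that is contained in `I`
and untouched by the routing; a path through `v` can use this layer instead of `v`
(`Layering.routable_diff_singleton`). Hence the vertices that are not kept can be removed one by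
one, a new shortest routing being chosen each time.

The program keeps its data in arrays, and registers serve only as counters of loops. An invariant
rule for counting loops (`Runs.forLoop`), which also accounts for the running time and for the
arrays that stay unchanged, reduces the verification to the invariants of the single loops.
-/

namespace EDP

open SimpleGraph

/-! ### Routings of minimum total length -/

section Routing

variable {V ι : Type*} {G : SimpleGraph V} {s t : ι → V}

/-- Pairwise edge-disjoint walks `W i` from `s i` to `t i`. -/
def EdgeDisjoint (W : ∀ i, G.Walk (s i) (t i)) : Prop :=
  ∀ i j, i ≠ j → List.Disjoint (W i).edges (W j).edges

/-- A routing by edge-disjoint walks whose total length is as small as possible. -/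
def IsShortest [Fintype ι] (W : ∀ i, G.Walk (s i) (t i)) : Prop :=
  EdgeDisjoint W ∧ ∀ W' : ∀ i, G.Walk (s i) (t i), EdgeDisjoint W' →
    ∑ i, (W i).length ≤ ∑ i, (W' i).length

theorem exists_isShortest [Fintype ι] (h : ∃ W : ∀ i, G.Walk (s i) (t i), EdgeDisjoint W) :
    ∃ W : ∀ i, G.Walk (s i) (t i), IsShortest W := by
  classical
  have hne : ∃ N : ℕ, ∃ W : ∀ i, G.Walk (s i) (t i), EdgeDisjoint W ∧
      ∑ i, (W i).length = N := by
    obtain ⟨W, hW⟩ := h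
    exact ⟨_, W, hW, rfl⟩
  obtain ⟨W, hW, hN⟩ := Nat.find_spec hne
  refine ⟨W, hW, fun W' hW' => ?_⟩
  rw [hN]
  exact Nat.find_min' hne ⟨W', hW', rfl⟩

theorem IsShortest.length_le [Fintype ι] {W : ∀ i, G.Walk (s i) (t i)} (hW : IsShortest W)
    (i : ι) (w : G.Walk (s i) (t i))
    (hw : ∀ e ∈ w.edges, ∀ j, j ≠ i → e ∉ (W j).edges) : (W i).length ≤ w.length := by
  classical
  have hd : EdgeDisjoint (Function.update W i w) := by
    intro a b hab e hea heb
    by_cases ha : a = i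
    · subst ha
      have hb : b ≠ a := fun h => hab h.symm
      rw [Function.update_self] at hea
      rw [Function.update_of_ne hb] at heb
      exact hw e hea b hb heb
    · rw [Function.update_of_ne ha] at hea
      by_cases hb : b = i
      · subst hb
        rw [Function.update_self] at heb
        exact hw e heb a ha hea
      · rw [Function.update_of_ne hb] at heb
        exact hW.1 a b hab hea heb
  have h := hW.2 _ hd
  rw [← Finset.add_sum_erase _ _ (Finset.mem_univ i),
    ← Finset.add_sum_erase _ _ (Finset.mem_univ i), Function.update_self] at h
  have : ∑ x ∈ Finset.univ.erase i, (Function.update W i w x).length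
      = ∑ x ∈ Finset.univ.erase i, (W x).length := by
    refine Finset.sum_congr rfl fun x hx => ?_
    rw [Function.update_of_ne (Finset.ne_of_mem_erase hx)]
  omega

theorem IsShortest.length_add_length_le [Fintype ι] {W : ∀ i, G.Walk (s i) (t i)}
    (hW : IsShortest W) {i j : ι} (hij : i ≠ j) (w : G.Walk (s i) (t i)) (w' : G.Walk (s j) (t j))
    (hw : ∀ e ∈ w.edges, e ∈ (W i).edges ∨ e ∈ (W j).edges)
    (hw' : ∀ e ∈ w'.edges, e ∈ (W i).edges ∨ e ∈ (W j).edges)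
    (hww' : List.Disjoint w.edges w'.edges) :
    (W i).length + (W j).length ≤ w.length + w'.length := by
  classical
  have key : ∀ a, a ≠ i → a ≠ j → ∀ e ∈ (W a).edges, e ∉ w.edges ∧ e ∉ w'.edges := by
    intro a hi hj e he
    constructor
    · intro h
      rcases hw e h with h | h
      · exact hW.1 a i hi he h
      · exact hW.1 a j hj he h
    · intro h
      rcases hw' e h with h | h
      · exact hW.1 a i hi he h
      · exact hW.1 a j hj he h
  set W' := Function.update (Function.update W i w) j w' with hW'
  have hi : W' i = w := by
    rw [hW', Function.update_of_ne hij, Function.update_self]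
  have hj : W' j = w' := by rw [hW', Function.update_self]
  have ho : ∀ a, a ≠ i → a ≠ j → W' a = W a := by
    intro a hai haj
    rw [hW', Function.update_of_ne haj, Function.update_of_ne hai]
  have hd : EdgeDisjoint W' := by
    intro a b hab e hea heb
    rcases eq_or_ne a i with rfl | hai
    · rw [hi] at hea
      rcases eq_or_ne b j with rfl | hbj
      · rw [hj] at heb
        exact hww' hea heb
      · rw [ho b hab.symm hbj] at heb
        exact (key b hab.symm hbj e heb).1 hea
    · rcases eq_or_ne a j with rfl | haj
      · rw [hj] at hea
        rcases eq_or_ne b i with rfl | hbi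
        · rw [hi] at heb
          exact hww' heb hea
        · rw [ho b hbi hab.symm] at heb
          exact (key b hbi hab.symm e heb).2 hea
      · rw [ho a hai haj] at hea
        rcases eq_or_ne b i with rfl | hbi
        · rw [hi] at heb
          exact (key a hai haj e hea).1 heb
        · rcases eq_or_ne b j with rfl | hbj
          · rw [hj] at heb
            exact (key a hai haj e hea).2 heb
          · rw [ho b hbi hbj] at heb
            exact hW.1 a b hab hea heb
  have h := hW.2 _ hd
  have hmem : j ∈ Finset.univ.erase i := Finset.mem_erase.2 ⟨hij.symm, Finset.mem_univ j⟩
  rw [← Finset.add_sum_erase _ _ (Finset.mem_univ i), ← Finset.add_sum_erase _ _ hmem,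
    ← Finset.add_sum_erase _ (fun x => (W' x).length) (Finset.mem_univ i),
    ← Finset.add_sum_erase _ (fun x => (W' x).length) hmem, hi, hj] at h
  have : ∑ x ∈ (Finset.univ.erase i).erase j, (W' x).length
      = ∑ x ∈ (Finset.univ.erase i).erase j, (W x).length := by
    refine Finset.sum_congr rfl fun x hx => ?_
    rw [ho x (Finset.ne_of_mem_erase (Finset.mem_of_mem_erase hx)) (Finset.ne_of_mem_erase hx)]
  omega

theorem IsShortest.isPath [Fintype ι] {W : ∀ i, G.Walk (s i) (t i)} (hW : IsShortest W)
    (i : ι) : (W i).IsPath := by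
  classical
  have h := hW.length_le i (W i).bypass fun e he j hj hej =>
    hW.1 i j hj.symm ((W i).edges_bypass_subset_edges he) hej
  rw [← (W i).bypass_eq_self_of_length_le_length_bypass h]
  exact (W i).bypass_isPath

/-- A walk is cut in two at one of its edges. -/
theorem exists_split_of_mem_edges {x y : V} (p : G.Walk x y) {e : Sym2 V} (he : e ∈ p.edges) :
    ∃ (u w : V) (p₁ : G.Walk x u) (p₂ : G.Walk w y), s(u, w) = e ∧
      p.edges = p₁.edges ++ e :: p₂.edges ∧ p.support = p₁.support ++ p₂.support := by
  induction p with
  | nil => simp at he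
  | @cons x z y h q ih =>
    rw [Walk.edges_cons, List.mem_cons] at he
    by_cases hx : e = s(x, z)
    · exact ⟨x, z, .nil, q, hx.symm, by simp [hx], by simp⟩
    · obtain ⟨u, w, p₁, p₂, h₁, h₂, h₃⟩ := ih (he.resolve_left hx)
      exact ⟨u, w, .cons h p₁, p₂, h₁, by simp [h₂], by simp [h₃]⟩

theorem exists_segment {x y : V} (p : G.Walk x y) {a b : ℕ} (hab : a ≤ b) (hb : b ≤ p.length) :
    ∃ q : G.Walk (p.getVert a) (p.getVert b),
      q.edges = (p.edges.drop a).take (b - a) ∧ q.length = b - a := by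
  have h : (p.drop a).getVert (b - a) = p.getVert b := by
    rw [Walk.drop_getVert, Nat.add_sub_cancel' hab]
  refine ⟨((p.drop a).take (b - a)).copy rfl h, ?_, ?_⟩
  · rw [Walk.edges_copy, Walk.edges_take, Walk.edges_drop]
  · rw [Walk.length_copy, Walk.take_length, Walk.drop_length]
    omega

theorem edges_getElem_eq {x y : V} (p : G.Walk x y) {m : ℕ} (hm : m < p.edges.length) :
    p.edges[m] = s(p.getVert m, p.getVert (m + 1)) := by
  have h : m < p.darts.length := by simpa [Walk.edges] using hm
  simp only [Walk.edges, List.getElem_map]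
  rw [Walk.darts_getElem_eq_getVert m h]
  rfl

theorem chord_notMem_edges {x y : V} {p : G.Walk x y} (hp : p.IsPath) {a b : ℕ}
    (hab : a + 2 ≤ b) (hb : b ≤ p.length) : s(p.getVert a, p.getVert b) ∉ p.edges := by
  intro he
  obtain ⟨m, hm, h⟩ := List.getElem_of_mem he
  rw [edges_getElem_eq] at h
  rw [Walk.length_edges] at hm
  have inj := hp.getVert_injOn
  have ha' : a ∈ {i | i ≤ p.length} := by simp; omega
  have hb' : b ∈ {i | i ≤ p.length} := by simp; omega
  have hm' : m ∈ {i | i ≤ p.length} := by simp; omega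
  have hm'' : m + 1 ∈ {i | i ≤ p.length} := by simp; omega
  rw [Sym2.eq_iff] at h
  rcases h with ⟨h₁, h₂⟩ | ⟨h₁, h₂⟩
  · have := inj hm' ha' h₁
    have := inj hm'' hb' h₂
    omega
  · have := inj hm' hb' h₁
    have := inj hm'' ha' h₂
    omega

/-- A chord of a path of a shortest routing is an edge of another path: otherwise the chord would be
a shortcut. -/
theorem IsShortest.exists_mem_edges_of_chord [Fintype ι] {W : ∀ i, G.Walk (s i) (t i)}
    (hW : IsShortest W) (i : ι) {a b : ℕ} (hab : a + 2 ≤ b) (hb : b ≤ (W i).length)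
    (hadj : G.Adj ((W i).getVert a) ((W i).getVert b)) :
    ∃ j, j ≠ i ∧ s((W i).getVert a, (W i).getVert b) ∈ (W j).edges := by
  by_contra! hcon
  have h := hW.length_le i (((W i).take a).append (.cons hadj ((W i).drop b))) (by
    intro e he j hj hej
    simp only [Walk.edges_append, Walk.edges_cons, List.mem_append, List.mem_cons, Walk.edges_take,
      Walk.edges_drop] at he
    rcases he with he | he | he
    · exact hW.1 i j hj.symm (List.mem_of_mem_take he) hej
    · subst he
      exact hcon j hj hej
    · exact hW.1 i j hj.symm (List.mem_of_mem_drop he) hej)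
  rw [Walk.length_append, Walk.length_cons, Walk.take_length, Walk.drop_length] at h
  omega

/-- If a chord of the path `W i` is an edge of the path `W j`, then `W j` avoids the vertices that
the chord skips: otherwise, exchanging the chord and the skipped segment between the two paths
would create a closed detour in `W j`, and leaving it out would shorten the routing. -/
theorem IsShortest.notMem_support_of_chord [Fintype ι] {W : ∀ i, G.Walk (s i) (t i)}
    (hW : IsShortest W) {i j : ι} {a b c : ℕ} (hac : a < c) (hcb : c < b)
    (hb : b ≤ (W i).length)
    (hadj : G.Adj ((W i).getVert a) ((W i).getVert b))
    (he : s((W i).getVert a, (W i).getVert b) ∈ (W j).edges) :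
    (W i).getVert c ∉ (W j).support := by
  classical
  intro hc
  have hpi := hW.isPath i
  have hpj := hW.isPath j
  have hchord := chord_notMem_edges hpi (by omega : a + 2 ≤ b) hb
  have hij : i ≠ j := by
    rintro rfl
    exact hchord he
  obtain ⟨u, w, p₁, p₂, huw, hedges, hsupp⟩ := exists_split_of_mem_edges _ he
  set e := s((W i).getVert a, (W i).getVert b) with hedef
  set S := ((W i).edges.drop a).take (b - a) with hS
  have hSmem : ∀ f ∈ S, f ∈ (W i).edges := fun f hf =>
    List.mem_of_mem_drop (List.mem_of_mem_take hf)
  have hndj : (p₁.edges ++ e :: p₂.edges).Nodup := by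
    rw [← hedges]
    exact hpj.isTrail.edges_nodup
  -- From the common vertex, both ends of the chord are reached inside the skipped segment.
  have hseg : ∀ z, z = (W i).getVert a ∨ z = (W i).getVert b →
      ∃ r : G.Walk ((W i).getVert c) z, r.edges ⊆ S ∧ r.length + 1 ≤ b - a := by
    rintro z (rfl | rfl)
    · obtain ⟨q, hq, hl⟩ := exists_segment (W i) hac.le (by omega)
      refine ⟨q.reverse, ?_, ?_⟩
      · intro f hf
        rw [Walk.edges_reverse, List.mem_reverse, hq] at hf
        exact List.take_subset_take_left _ (by omega) hf
      · rw [Walk.length_reverse, hl]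
        omega
    · obtain ⟨q, hq, hl⟩ := exists_segment (W i) hcb.le hb
      refine ⟨q, ?_, by omega⟩
      intro f hf
      rw [hq] at hf
      have h1 : (W i).edges.drop c = ((W i).edges.drop a).drop (c - a) := by
        rw [List.drop_drop, Nat.add_sub_cancel' hac.le]
      rw [h1, List.take_drop] at hf
      have h2 := List.mem_of_mem_drop hf
      rwa [show c - a + (b - c) = b - a by omega] at h2
  have hu : u = (W i).getVert a ∧ w = (W i).getVert b ∨
      u = (W i).getVert b ∧ w = (W i).getVert a := by
    rw [hedef, Sym2.eq_iff] at huw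
    exact huw
  obtain ⟨w', hw'sub, hw'len⟩ : ∃ w' : G.Walk (s j) (t j),
      (∀ f ∈ w'.edges, f ∈ p₁.edges ∨ f ∈ p₂.edges ∨ f ∈ S) ∧
      w'.length + 1 ≤ p₁.length + p₂.length + (b - a) := by
    rw [hsupp, List.mem_append] at hc
    rcases hc with hc | hc
    · obtain ⟨r, hr, hrl⟩ := hseg w (by tauto)
      refine ⟨(p₁.takeUntil _ hc).append (r.append p₂), ?_, ?_⟩
      · intro f hf
        simp only [Walk.edges_append, List.mem_append] at hf
        rcases hf with hf | hf | hf
        · exact .inl (p₁.edges_takeUntil_subset_edges hc hf)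
        · exact .inr (.inr (hr hf))
        · exact .inr (.inl hf)
      · have := p₁.length_takeUntil_le_length hc
        simp only [Walk.length_append]
        omega
    · obtain ⟨r, hr, hrl⟩ := hseg u (by tauto)
      refine ⟨p₁.append (r.reverse.append (p₂.dropUntil _ hc)), ?_, ?_⟩
      · intro f hf
        simp only [Walk.edges_append, List.mem_append, Walk.edges_reverse, List.mem_reverse] at hf
        rcases hf with hf | hf | hf
        · exact .inl hf
        · exact .inr (.inr (hr hf))
        · exact .inr (.inl (p₂.edges_dropUntil_subset_edges hc hf))
      · have := p₂.length_dropUntil_le_length hc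
        simp only [Walk.length_append, Walk.length_reverse]
        omega
  have hdec : (W i).edges = (W i).edges.take a ++ (S ++ (W i).edges.drop b) := by
    conv_lhs => rw [← List.take_append_drop a (W i).edges]
    congr 1
    conv_lhs => rw [← List.take_append_drop (b - a) ((W i).edges.drop a)]
    rw [List.drop_drop, Nat.add_sub_cancel' (by omega : a ≤ b)]
  have hndi : ((W i).edges.take a ++ (S ++ (W i).edges.drop b)).Nodup := by
    rw [← hdec]
    exact hpi.isTrail.edges_nodup
  rw [List.nodup_append'] at hndi hndj
  have hndi2 := List.nodup_append'.1 hndi.2.1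
  have hj : ∀ f, f ∈ p₁.edges ∨ f ∈ p₂.edges → f ∈ (W j).edges := by
    intro f hf
    rw [hedges, List.mem_append, List.mem_cons]
    tauto
  have hlen := hW.length_add_length_le hij
    (((W i).take a).append (.cons hadj ((W i).drop b))) w' (by
      intro f hf
      simp only [Walk.edges_append, Walk.edges_cons, List.mem_append, List.mem_cons,
        Walk.edges_take, Walk.edges_drop] at hf
      rcases hf with hf | hf | hf
      · exact .inl (List.mem_of_mem_take hf)
      · subst hf
        exact .inr he
      · exact .inl (List.mem_of_mem_drop hf))
    (by
      intro f hf
      rcases hw'sub f hf with hf | hf | hf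
      · exact .inr (hj f (.inl hf))
      · exact .inr (hj f (.inr hf))
      · exact .inl (hSmem f hf))
    (by
      intro f hf hf'
      simp only [Walk.edges_append, Walk.edges_cons, List.mem_append, List.mem_cons,
        Walk.edges_take, Walk.edges_drop] at hf
      have hfS : f ∈ (W i).edges → f ∈ S := by
        intro hfi
        rcases hw'sub f hf' with h | h | h
        · exact absurd (hj f (.inl h)) (fun h' => hW.1 i j hij hfi h')
        · exact absurd (hj f (.inr h)) (fun h' => hW.1 i j hij hfi h')
        · exact h
      rcases hf with hf | hf | hf
      · exact hndi.2.2 hf (List.mem_append_left _ (hfS (List.mem_of_mem_take hf)))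
      · rw [← hedef] at hf
        subst hf
        rcases hw'sub _ hf' with h | h | h
        · exact hndj.2.2 h (by simp)
        · exact (List.nodup_cons.1 hndj.2.1).1 h
        · exact hchord (hSmem _ h)
      · exact hndi2.2.2 (hfS (List.mem_of_mem_drop hf)) hf)
  have hl : (W j).length = p₁.length + (p₂.length + 1) := by
    rw [← Walk.length_edges, hedges]
    simp
  rw [Walk.length_append, Walk.length_cons, Walk.take_length, Walk.drop_length, hl] at hlen
  omega

/-- If every edge of the graph has an end in the clique `C`, then the paths of a shortest
routing have length `O(√k)`. Among the first half of a longer path and among its second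
half there are `r` vertices of `C` each; the `r ^ 2` chords between them lie on distinct paths,
since of two such chords at least one skips an end of the other. -/
theorem IsShortest.length_le_of_isClique [Fintype ι] {W : ∀ i, G.Walk (s i) (t i)}
    (hW : IsShortest W) {C : Set V} (hC : ∀ x ∈ C, ∀ y ∈ C, x ≠ y → G.Adj x y)
    (hcov : ∀ x y, G.Adj x y → x ∈ C ∨ y ∈ C) {r : ℕ} (hr : Fintype.card ι < r * r) (i : ι) :
    (W i).length ≤ 4 * r := by
  classical
  by_contra! hlong
  set p := W i with hp
  have hpath : p.IsPath := hW.isPath i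
  have hex : ∀ m, ∃ a, (a = 2 * m ∨ a = 2 * m + 1) ∧ (m ≤ 2 * r → p.getVert a ∈ C) := by
    intro m
    by_cases hm : m ≤ 2 * r
    · rcases hcov _ _ (p.adj_getVert_succ (i := 2 * m) (by omega)) with h | h
      · exact ⟨_, .inl rfl, fun _ => h⟩
      · exact ⟨_, .inr rfl, fun _ => h⟩
    · exact ⟨_, .inl rfl, fun h => absurd h hm⟩
  choose α hα hαC using hex
  have hbd : ∀ m m' : Fin r, α m + 2 ≤ α (r + 1 + m') ∧ α (r + 1 + m') ≤ p.length := by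
    intro m m'
    have h1 := hα m
    have h2 := hα (r + 1 + m')
    have := m.2
    have := m'.2
    omega
  have hadj : ∀ m m' : Fin r, G.Adj (p.getVert (α m)) (p.getVert (α (r + 1 + m'))) := by
    intro m m'
    have hb := hbd m m'
    refine hC _ (hαC _ (by omega)) _ (hαC _ (by omega)) fun h => ?_
    have := hpath.getVert_injOn (by simp; omega) (by simp; omega) h
    omega
  choose f hf using fun m : Fin r × Fin r =>
    hW.exists_mem_edges_of_chord i (hbd m.1 m.2).1 (hbd m.1 m.2).2 (hadj m.1 m.2)
  have hinj : Function.Injective f := by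
    -- A chord that skips an end of another chord does not lie on the same path.
    have key : ∀ m m' : Fin r × Fin r, f m = f m' →
        ¬ (m.1 < m'.1) ∧ ¬ (m.1 = m'.1 ∧ m.2 < m'.2) := by
      intro m m' h
      have hb := hbd m.1 m.2
      have hb' := hbd m'.1 m'.2
      have h1 := hα m.1
      have h1' := hα m'.1
      have h2 := hα (r + 1 + m.2)
      have h2' := hα (r + 1 + m'.2)
      have l1 := m.1.2
      have l1' := m'.1.2
      constructor
      · intro hlt
        have hlt' : (m.1 : ℕ) < m'.1 := hlt
        refine hW.notMem_support_of_chord (i := i) (j := f m) (c := α m'.1) (by omega) (by omega)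
          hb.2 (hadj m.1 m.2) (hf m).2 ?_
        rw [h]
        exact Walk.fst_mem_support_of_mem_edges _ (hf m').2
      · rintro ⟨heq, hlt⟩
        have hlt' : (m.2 : ℕ) < m'.2 := hlt
        refine hW.notMem_support_of_chord (i := i) (j := f m') (c := α (r + 1 + m.2))
          (by rw [← heq]; omega) (by omega) hb'.2 (hadj m'.1 m'.2) (hf m').2 ?_
        rw [← h]
        exact Walk.snd_mem_support_of_mem_edges _ (hf m).2
    intro m m' h
    have k1 := key m m' h
    have k2 := key m' m h.symm
    have e1 : m.1 = m'.1 := le_antisymm (not_lt.1 k2.1) (not_lt.1 k1.1)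
    have e2 : m.2 = m'.2 :=
      le_antisymm (not_lt.1 fun h' => k2.2 ⟨e1.symm, h'⟩) (not_lt.1 fun h' => k1.2 ⟨e1, h'⟩)
    exact Prod.ext e1 e2
  have := Fintype.card_le_of_injective f hinj
  simp at this
  omega

end Routing

end EDP

namespace EDP

open SimpleGraph

/-! ### Removing a vertex whose neighbourhood is linked many times -/

section Layers

variable {V ι : Type*} {G : SimpleGraph V} {s t : ι → V}

/-- There are pairwise edge-disjoint walks from `s i` to `t i`. -/
def Routable (G : SimpleGraph V) (s t : ι → V) : Prop :=
  ∃ W : ∀ i, G.Walk (s i) (t i), EdgeDisjoint W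

/-- `x` and `y` are joined by a walk all of whose edges belong to `F`. -/
def Joined (F : Set (Sym2 V)) : V → V → Prop :=
  Relation.ReflTransGen fun x y => s(x, y) ∈ F

theorem Joined.symm {F : Set (Sym2 V)} {x y : V} (h : Joined F x y) : Joined F y x :=
  have : Std.Symm fun x y : V => s(x, y) ∈ F := ⟨fun x y h => by rwa [Sym2.eq_swap]⟩
  Relation.ReflTransGen.stdSymm.symm _ _ h

theorem Joined.trans {F : Set (Sym2 V)} {x y z : V} (h : Joined F x y) (h' : Joined F y z) :
    Joined F x z :=
  Relation.ReflTransGen.trans h h'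

theorem Joined.of_mem {F : Set (Sym2 V)} {x y : V} (h : s(x, y) ∈ F) : Joined F x y :=
  Relation.ReflTransGen.single h

theorem Joined.mono {F F' : Set (Sym2 V)} (h : F ⊆ F') {x y : V} (hxy : Joined F x y) :
    Joined F' x y :=
  Relation.ReflTransGen.mono (fun _ _ h' => h h') _ _ hxy

theorem Joined.of_walk {x y : V} (p : G.Walk x y) : Joined {e | e ∈ p.edges} x y := by
  induction p with
  | nil => exact .refl
  | @cons x z y h p ih =>
    exact (Joined.of_mem (by simp)).trans (ih.mono fun e he => by simp_all)

theorem Joined.exists_walk {F : Set (Sym2 V)} (hF : F ⊆ G.edgeSet) {x y : V} (h : Joined F x y) :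
    ∃ p : G.Walk x y, ∀ e ∈ p.edges, e ∈ F := by
  induction h with
  | refl => exact ⟨.nil, by simp⟩
  | @tail y z _ hyz ih =>
    obtain ⟨p, hp⟩ := ih
    have hadj : G.Adj y z := hF hyz
    refine ⟨p.concat hadj, fun e he => ?_⟩
    rw [Walk.edges_concat, List.concat_eq_append, List.mem_append, List.mem_singleton] at he
    rcases he with he | rfl
    · exact hp e he
    · exact hyz

theorem routable_of_joined (F : ι → Set (Sym2 V)) (hF : ∀ i, F i ⊆ G.edgeSet)
    (hd : ∀ i j, i ≠ j → Disjoint (F i) (F j)) (hj : ∀ i, Joined (F i) (s i) (t i)) :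
    Routable G s t := by
  choose W hW using fun i => (hj i).exists_walk (hF i)
  exact ⟨W, fun i j hij e hi hj => Set.disjoint_left.1 (hd i j hij) (hW i e hi) (hW j e hj)⟩

/-- Edges at `v` can be dispensed with if the neighbours of `v` are joined otherwise. -/
theorem Joined.avoid {F F' : Set (Sym2 V)} {v : V}
    (hF : ∀ x y, s(x, y) ∈ F → x ≠ v → y ≠ v → Joined F' x y)
    (hv : ∀ x y, s(x, v) ∈ F → s(v, y) ∈ F → x ≠ v → y ≠ v → Joined F' x y)
    {x y : V} (h : Joined F x y) (hx : x ≠ v) (hy : y ≠ v) : Joined F' x y := by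
  have key : (y ≠ v → Joined F' x y) ∧
      (y = v → ∀ z, s(v, z) ∈ F → z ≠ v → Joined F' x z) := by
    clear hy
    induction h with
    | refl => exact ⟨fun _ => .refl, fun h => absurd h hx⟩
    | @tail y z _ hyz ih =>
      by_cases hyv : y = v
      · subst hyv
        exact ⟨fun hz => ih.2 rfl z hyz hz, fun hz w hw hwv => ih.2 rfl w hw hwv⟩
      · refine ⟨fun hz => (ih.1 hyv).trans (hF y z hyz hyv hz), ?_⟩
        rintro rfl w hw hwv
        exact (ih.1 hyv).trans (hv y w hyz hw hyv hwv)
  exact key.1 hy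

/-- The graph `G` without the edges that leave `K`. -/
def restrict (G : SimpleGraph V) (K : Set V) : SimpleGraph V where
  Adj x y := G.Adj x y ∧ x ∈ K ∧ y ∈ K
  symm := ⟨fun _ _ h => ⟨h.1.symm, h.2.2, h.2.1⟩⟩
  loopless := ⟨fun _ h => G.loopless.irrefl _ h.1⟩

/-- The equivalence relation on the vertices that is generated by identifying any two vertices
with a common neighbour in `S`. -/
def Linked (G : SimpleGraph V) (S : Set V) : V → V → Prop :=
  Relation.EqvGen fun x y => ∃ a ∈ S, G.Adj a x ∧ G.Adj a y

/-- Disjoint sets `L 0, …, L (f - 1)` of vertices of `K` such that the neighbours of any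
vertex outside `K` are linked through each of these sets. -/
structure Layering (G : SimpleGraph V) (f : ℕ) (K : Set V) (L : ℕ → Set V) : Prop where
  subset : ∀ j < f, L j ⊆ K
  disjoint : ∀ i < f, ∀ j < f, i ≠ j → Disjoint (L i) (L j)
  linked : ∀ v ∉ K, ∀ j < f, ∀ x y, G.Adj v x → G.Adj v y → Linked G (L j) x y

/-- The edges of `restrict G K` with an end in `S`. -/
def edgesAt (G : SimpleGraph V) (K S : Set V) : Set (Sym2 V) :=
  {e | e ∈ (restrict G K).edgeSet ∧ ∃ a ∈ S, a ∈ e}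

theorem mem_clique_of_adj {C : Set V} (hI : G.IsIndepSet Cᶜ) {x y : V} (h : G.Adj x y)
    (hx : x ∉ C) : y ∈ C := by
  by_contra hy
  exact hI hx hy h.ne h

theorem Linked.eq_or_mem {C S : Set V} (hI : G.IsIndepSet Cᶜ) (hS : ∀ a ∈ S, a ∉ C) {x y : V}
    (h : Linked G S x y) : x = y ∨ x ∈ C ∧ y ∈ C := by
  induction h with
  | rel x y h =>
    obtain ⟨a, ha, hx, hy⟩ := h
    exact .inr ⟨mem_clique_of_adj hI hx (hS a ha), mem_clique_of_adj hI hy (hS a ha)⟩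
  | refl => exact .inl rfl
  | symm x y _ ih =>
    rcases ih with rfl | ih
    · exact .inl rfl
    · exact .inr ih.symm
  | trans x y z _ _ ih ih' =>
    rcases ih with rfl | ih
    · exact ih'
    · rcases ih' with rfl | ih'
      · exact .inr ih
      · exact .inr ⟨ih.1, ih'.2⟩

/-- A layer inside the independent set links its neighbours without using removed vertices. If
`x` were removed, its neighbours `a ∈ L j` and `y` would be linked through `L j`; but `L j`
links only vertices of the clique, and `a` is not one of them. -/
theorem Layering.mem_of_adj {f : ℕ} {K : Set V} {L : ℕ → Set V} (hL : Layering G f K L)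
    {C : Set V} (hC : G.IsClique C) (hI : G.IsIndepSet Cᶜ) {j : ℕ} (hj : j < f)
    (hjC : ∀ a ∈ L j, a ∉ C) {a x y : V} (ha : a ∈ L j) (hx : G.Adj a x) (hy : G.Adj a y)
    (hxy : x ≠ y) : x ∈ K := by
  by_contra hxK
  have hxC := mem_clique_of_adj hI hx (hjC a ha)
  have hyC := mem_clique_of_adj hI hy (hjC a ha)
  have h := hL.linked x hxK j hj a y hx.symm (hC hxC hyC hxy)
  rcases h.eq_or_mem hI hjC with h | h
  · exact hjC a ha (h ▸ hyC)
  · exact hjC a ha h.1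

theorem Layering.joined {f : ℕ} {K : Set V} {L : ℕ → Set V} (hL : Layering G f K L)
    {C : Set V} (hC : G.IsClique C) (hI : G.IsIndepSet Cᶜ) {j : ℕ} (hj : j < f)
    (hjC : ∀ a ∈ L j, a ∉ C) {K' : Set V} (hK : K ⊆ K') {x y : V} (h : Linked G (L j) x y) :
    Joined (edgesAt G K' (L j)) x y := by
  induction h with
  | rel x y h =>
    obtain ⟨a, ha, hx, hy⟩ := h
    by_cases hxy : x = y
    · subst hxy
      exact .refl
    · have haK := hK (hL.subset j hj ha)
      have hxK := hK (hL.mem_of_adj hC hI hj hjC ha hx hy hxy)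
      have hyK := hK (hL.mem_of_adj hC hI hj hjC ha hy hx (Ne.symm hxy))
      have h₁ : s(a, x) ∈ edgesAt G K' (L j) := ⟨⟨hx, haK, hxK⟩, a, ha, by simp⟩
      have h₂ : s(a, y) ∈ edgesAt G K' (L j) := ⟨⟨hy, haK, hyK⟩, a, ha, by simp⟩
      exact (Joined.of_mem h₁).symm.trans (Joined.of_mem h₂)
  | refl => exact .refl
  | symm x y _ ih => exact ih.symm
  | trans x y z _ _ ih ih' => exact ih.trans ih'

/-- Few of the disjoint layers meet a given finite set. -/
theorem Layering.exists_avoiding [Fintype ι] {f : ℕ} {K : Set V} {L : ℕ → Set V}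
    (hL : Layering G f K L) (B : Finset V) (hf : B.card + Fintype.card ι ≤ f) :
    ∃ g : ι → ℕ, Function.Injective g ∧ ∀ i, g i < f ∧ ∀ a ∈ L (g i), a ∉ B := by
  classical
  set bad := (Finset.range f).filter fun j => ∃ a ∈ L j, a ∈ B with hbad
  have hcard : bad.card ≤ B.card := by
    refine Finset.card_le_card_of_forall_subsingleton (fun j a => a ∈ L j)
      (fun j hj => ?_) fun a _ i hi j hj => ?_
    · obtain ⟨a, ha, haB⟩ := (Finset.mem_filter.1 hj).2
      exact ⟨a, haB, ha⟩
    · by_contra hne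
      have hi' := Finset.mem_range.1 (Finset.mem_filter.1 hi.1).1
      have hj' := Finset.mem_range.1 (Finset.mem_filter.1 hj.1).1
      exact Set.disjoint_left.1 (hL.disjoint i hi' j hj' hne) hi.2 hj.2
  have hgood : Fintype.card ι ≤ Fintype.card {j // j ∈ Finset.range f \ bad} := by
    have hsub : bad ⊆ Finset.range f := Finset.filter_subset _ _
    rw [Fintype.card_coe, Finset.card_sdiff_of_subset hsub, Finset.card_range]
    omega
  obtain ⟨g⟩ := Function.Embedding.nonempty_of_card_le hgood
  refine ⟨fun i => g i, fun i j h => g.injective (Subtype.ext h), fun i => ?_⟩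
  have h := Finset.mem_sdiff.1 (g i).2
  refine ⟨Finset.mem_range.1 h.1, fun a ha haB => h.2 ?_⟩
  exact Finset.mem_filter.2 ⟨h.1, a, ha, haB⟩

/-- A vertex outside `K` is superfluous. In a shortest routing only few vertices are touched, so
that each path has a layer of its own which lies in the independent set and is untouched; the
path can use this layer instead of the removed vertex `v`. -/
theorem Layering.routable_diff_singleton [Fintype ι] {f : ℕ} {K : Set V} {L : ℕ → Set V}
    (hL : Layering G f K L) {C : Finset V} (hC : G.IsClique (C : Set V))
    (hI : G.IsIndepSet (C : Set V)ᶜ) {r : ℕ} (hr : Fintype.card ι < r * r)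
    (hf : C.card + Fintype.card ι * (4 * r + 2) ≤ f) {K' : Set V} (hK : K ⊆ K') {v : V}
    (hv : v ∉ K) (hs : ∀ i, s i ∈ K) (ht : ∀ i, t i ∈ K) (h : Routable (restrict G K') s t) :
    Routable (restrict G (K' \ {v})) s t := by
  classical
  obtain ⟨W, hW⟩ := exists_isShortest h
  have hlen : ∀ i, (W i).length ≤ 4 * r := fun i => by
    refine hW.length_le_of_isClique (C := (C : Set V) ∩ K') ?_ ?_ hr i
    · exact fun x hx y hy hxy => ⟨hC hx.1 hy.1 hxy, hx.2, hy.2⟩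
    · rintro x y ⟨hxy, hx, hy⟩
      by_cases hxC : x ∈ (C : Set V)
      · exact .inl ⟨hxC, hx⟩
      · exact .inr ⟨mem_clique_of_adj hI hxy hxC, hy⟩
  set T : Finset V := Finset.univ.biUnion fun i => (W i).support.toFinset with hT
  have hTcard : T.card ≤ Fintype.card ι * (4 * r + 1) := by
    refine Finset.card_biUnion_le_card_mul _ _ _ fun i _ => ?_
    refine (List.toFinset_card_le _).trans ?_
    rw [Walk.length_support]
    have := hlen i
    omega
  obtain ⟨g, hg, hgood⟩ := hL.exists_avoiding (ι := ι) (C ∪ T) (by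
    have := Finset.card_union_le C T
    nlinarith)
  have hgC : ∀ i, ∀ a ∈ L (g i), a ∉ (C : Set V) := fun i a ha haC =>
    (hgood i).2 a ha (Finset.mem_union_left _ haC)
  have hgT : ∀ i, ∀ a ∈ L (g i), ∀ j, a ∉ (W j).support := fun i a ha j haj =>
    (hgood i).2 a ha (Finset.mem_union_right _ (Finset.mem_biUnion.2
      ⟨j, Finset.mem_univ j, List.mem_toFinset.2 haj⟩))
  have hKv : K ⊆ K' \ {v} := fun x hx => ⟨hK hx, fun h => hv (h ▸ hx)⟩
  refine routable_of_joined
    (fun i => {e | e ∈ (W i).edges ∧ v ∉ e} ∪ edgesAt G (K' \ {v}) (L (g i))) ?_ ?_ ?_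
  · rintro i e (⟨he, hve⟩ | he)
    · induction e with
      | _ x y =>
        obtain ⟨hxy, hx, hy⟩ := (W i).edges_subset_edgeSet he
        simp only [Sym2.mem_iff, not_or] at hve
        exact ⟨hxy, ⟨hx, fun h => hve.1 h.symm⟩, hy, fun h => hve.2 h.symm⟩
    · exact he.1
  · intro i j hij
    rw [Set.disjoint_left]
    have hmem : ∀ i j, ∀ e ∈ (W i).edges, ¬ ∃ a ∈ L (g j), a ∈ e := by
      rintro i j e he ⟨a, ha, hae⟩
      exact hgT j a ha i (Walk.mem_support_of_mem_edges he hae)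
    rintro e (⟨he, -⟩ | ⟨he, ha⟩) (⟨he', -⟩ | ⟨he', ha'⟩)
    · exact hW.1 i j hij he he'
    · exact hmem i j e he ha'
    · exact hmem j i e he' ha
    · obtain ⟨a, ha, hae⟩ := ha
      obtain ⟨a', ha', hae'⟩ := ha'
      have hne : a ≠ a' := by
        rintro rfl
        exact Set.disjoint_left.1 (hL.disjoint _ (hgood i).1 _ (hgood j).1 (hg.ne hij)) ha ha'
      have : e = s(a, a') := (Sym2.mem_and_mem_iff hne).1 ⟨hae, hae'⟩
      subst this
      exact hI (hgC i a ha) (hgC j a' ha') hne he.1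
  · intro i
    refine Joined.avoid (v := v) ?_ ?_ (Joined.of_walk (W i)) (fun h => hv (h ▸ hs i))
      (fun h => hv (h ▸ ht i))
    · intro x y hxy hx hy
      refine Joined.of_mem (.inl ⟨hxy, ?_⟩)
      rw [Sym2.mem_iff, not_or]
      exact ⟨hx.symm, hy.symm⟩
    · intro x y hx hy _ _
      have hxv : G.Adj v x := ((W i).edges_subset_edgeSet hx).1.symm
      have hyv : G.Adj v y := ((W i).edges_subset_edgeSet hy).1
      exact (hL.joined hC hI (hgood i).1 (hgC i) hKv
        (hL.linked v hv _ (hgood i).1 x y hxv hyv)).mono Set.subset_union_right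

theorem Layering.joined_diff_singleton {f : ℕ} {K : Set V} {L : ℕ → Set V}
    (hL : Layering G f K L) {C : Finset V} (hC : G.IsClique (C : Set V))
    (hI : G.IsIndepSet (C : Set V)ᶜ) (hf : C.card + 1 ≤ f) {K' : Set V} (hK : K ⊆ K') {v : V}
    (hv : v ∉ K) {x y : V} (hx : x ∈ K) (hy : y ∈ K)
    (h : Joined (restrict G K').edgeSet x y) :
    Joined (restrict G (K' \ {v})).edgeSet x y := by
  obtain ⟨g, -, hgood⟩ := hL.exists_avoiding (ι := Unit) C (by simpa using hf)
  have hKv : K ⊆ K' \ {v} := fun x hx => ⟨hK hx, fun h => hv (h ▸ hx)⟩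
  refine Joined.avoid (v := v) ?_ ?_ h (fun h => hv (h ▸ hx)) (fun h => hv (h ▸ hy))
  · intro x y hxy hx hy
    exact Joined.of_mem ⟨hxy.1, ⟨hxy.2.1, hx⟩, hxy.2.2, hy⟩
  · intro x y hx hy _ _
    exact (hL.joined hC hI (hgood ()).1 (hgood ()).2 hKv
        (hL.linked v hv _ (hgood ()).1 x y hx.1.symm hy.1)).mono fun e he => he.1

/-- A property of vertex sets that survives the removal of single vertices outside `K` passes
from the whole vertex set to `K`. -/
theorem of_diff_singleton [Finite V] {P : Set V → Prop} {K : Set V}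
    (hP : ∀ K', K ⊆ K' → ∀ v ∉ K, P K' → P (K' \ {v})) (h : P Set.univ) : P K := by
  have key : ∀ D : Set V, Disjoint D K → P Dᶜ := by
    intro D
    induction D, Set.toFinite D using Set.Finite.induction_on with
    | empty => simpa using h
    | @insert a D _ _ ih =>
      intro hD
      rw [Set.disjoint_insert_left] at hD
      have := hP Dᶜ (Set.disjoint_right.1 hD.2) a hD.1 (ih hD.2)
      rwa [Set.insert_eq, Set.compl_union, Set.inter_comm, ← Set.sdiff_eq]
  simpa using key Kᶜ disjoint_compl_left

theorem Layering.routable_restrict [Finite V] [Fintype ι] {f : ℕ} {K : Set V} {L : ℕ → Set V}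
    (hL : Layering G f K L) {C : Finset V} (hC : G.IsClique (C : Set V))
    (hI : G.IsIndepSet (C : Set V)ᶜ) {r : ℕ} (hr : Fintype.card ι < r * r)
    (hf : C.card + Fintype.card ι * (4 * r + 2) ≤ f) (hs : ∀ i, s i ∈ K) (ht : ∀ i, t i ∈ K)
    (h : Routable G s t) : Routable (restrict G K) s t := by
  refine of_diff_singleton (P := fun K' => Routable (restrict G K') s t)
    (fun K' hK v hv h => hL.routable_diff_singleton hC hI hr hf hK hv hs ht h) ?_
  have : restrict G Set.univ = G := by ext; simp [restrict]
  rwa [this]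

theorem Layering.joined_restrict [Finite V] {f : ℕ} {K : Set V} {L : ℕ → Set V}
    (hL : Layering G f K L) {C : Finset V} (hC : G.IsClique (C : Set V))
    (hI : G.IsIndepSet (C : Set V)ᶜ) (hf : C.card + 1 ≤ f) {x y : V} (hx : x ∈ K) (hy : y ∈ K)
    (h : Joined G.edgeSet x y) : Joined (restrict G K).edgeSet x y := by
  refine of_diff_singleton (P := fun K' => Joined (restrict G K').edgeSet x y)
    (fun K' hK v hv h => hL.joined_diff_singleton hC hI hf hK hv hx hy h) ?_
  have : restrict G Set.univ = G := by ext; simp [restrict]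
  rwa [this]

end Layers

end EDP

namespace EDP

open SimpleGraph

/-! ### Instances: large cliques, trivial instances, induced instances -/

namespace Instance

/-- The terminals, indexed by the number of the pair and a side. -/
def terminal (x : Instance) (o : Fin x.pairs.length × Bool) : Fin x.n :=
  if o.2 then (x.pairs.get o.1).1 else (x.pairs.get o.1).2

theorem terminal_ne (x : Instance) (i : Fin x.pairs.length) :
    x.terminal (i, true) ≠ x.terminal (i, false) :=
  x.ne_of_mem _ (x.pairs.get_mem i)

/-- The number of occurrences of the vertex `v` in the terminal pairs. -/
def occ (x : Instance) (v : Fin x.n) : ℕ :=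
  (Finset.univ.filter fun o => x.terminal o = v).card

open Classical in
/-- The degree of the vertex `v`. -/
noncomputable def deg (x : Instance) (v : Fin x.n) : ℕ :=
  (Finset.univ.filter fun w => x.graph.Adj v w).card

theorem isYes_iff (x : Instance) :
    x.IsYes ↔ Routable x.graph (fun i => x.terminal (i, true)) fun i => x.terminal (i, false) := by
  classical
  constructor
  · rintro ⟨P, hP⟩
    exact ⟨fun i => (P i).1, hP⟩
  · rintro ⟨W, hW⟩
    exact ⟨fun i => (W i).toPath, fun i j hij e he he' =>
      hW i j hij ((W i).edges_bypass_subset_edges he) ((W j).edges_bypass_subset_edges he')⟩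

theorem exists_mem_edges {V : Type*} {G : SimpleGraph V} {a b : V} (p : G.Walk a b) (hab : a ≠ b) :
    ∃ w, G.Adj a w ∧ s(a, w) ∈ p.edges := by
  cases p with
  | nil => exact absurd rfl hab
  | @cons _ w _ h q => exact ⟨w, h, by simp⟩

/-- In a Yes-instance each occurrence of a terminal needs an edge of its own. -/
theorem IsYes.occ_le_deg {x : Instance} (h : x.IsYes) (v : Fin x.n) : x.occ v ≤ x.deg v := by
  classical
  obtain ⟨W, hW⟩ := x.isYes_iff.1 h
  have hex : ∀ o, ∃ w, x.graph.Adj (x.terminal o) w ∧ s(x.terminal o, w) ∈ (W o.1).edges := by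
    rintro ⟨i, b⟩
    cases b with
    | true => exact exists_mem_edges (W i) (x.terminal_ne i)
    | false =>
      obtain ⟨w, hw, hmem⟩ := exists_mem_edges (W i).reverse (x.terminal_ne i).symm
      exact ⟨w, hw, by simpa using hmem⟩
  choose c hc hcW using hex
  refine Finset.card_le_card_of_injOn c ?_ ?_
  · intro o ho
    have ho' : x.terminal o = v := by simpa using ho
    simpa [ho'] using hc o
  · rintro ⟨i, b⟩ ho ⟨i', b'⟩ ho' heq
    have h1 : x.terminal (i, b) = v := by simpa using ho
    have h2 : x.terminal (i', b') = v := by simpa using ho'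
    have h3 := hcW (i, b)
    have h4 := hcW (i', b')
    rw [heq, h1] at h3
    rw [h2] at h4
    have hi : i = i' := by
      by_contra hne
      exact hW i i' hne h3 h4
    subst hi
    have := x.terminal_ne i
    cases b <;> cases b' <;> simp_all

/-- With a large clique, a routing exists as soon as the terminals have sufficient degree: each
terminal occurrence moves to the clique along an edge of its own, and then the `i`-th pair is
connected inside the clique through a vertex `m i` of its own. -/
theorem isYes_of_occ_le_deg {x : Instance} {C : Finset (Fin x.n)}
    (hC : x.graph.IsClique (C : Set (Fin x.n))) (hI : x.graph.IsIndepSet (C : Set (Fin x.n))ᶜ)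
    (hk : 3 * x.k ≤ C.card) (h : ∀ v, x.occ v ≤ x.deg v) : x.IsYes := by
  classical
  have hinj : ∀ v, ∃ g : {o // x.terminal o = v} → {w // x.graph.Adj v w},
      Function.Injective g := by
    intro v
    have hcard : Fintype.card {o // x.terminal o = v} ≤ Fintype.card {w // x.graph.Adj v w} := by
      rw [Fintype.card_subtype, Fintype.card_subtype]
      exact h v
    obtain ⟨g⟩ := Function.Embedding.nonempty_of_card_le hcard
    exact ⟨g, g.injective⟩
  choose g hg using hinj
  have hgg : ∀ o o' (ht : x.terminal o = x.terminal o'),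
      (g _ ⟨o, rfl⟩).1 = (g _ ⟨o', rfl⟩).1 → o = o' := by
    intro o o' ht heq
    have key : ∀ v (hv : x.terminal o = v) (hv' : x.terminal o' = v),
        (g v ⟨o, hv⟩).1 = (g v ⟨o', hv'⟩).1 → o = o' := fun v hv hv' hh =>
      congrArg Subtype.val (hg v (Subtype.ext hh))
    refine key _ rfl ht.symm ?_
    rw [heq]
    have aux : ∀ v (hv : x.terminal o' = v),
        (g (x.terminal o') ⟨o', rfl⟩).1 = (g v ⟨o', hv⟩).1 := by
      rintro v rfl
      rfl
    exact aux _ ht.symm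
  set a : Fin x.pairs.length × Bool → Fin x.n := fun o =>
    if x.terminal o ∈ C then x.terminal o else (g _ ⟨o, rfl⟩).1 with ha
  have haC : ∀ o, a o ∈ C := by
    intro o
    by_cases ho : x.terminal o ∈ C
    · simp [ha, ho]
    · simp only [ha, ho, if_false]
      exact mem_clique_of_adj hI (g _ ⟨o, rfl⟩).2 ho
  have hmid : ∃ m : Fin x.pairs.length → Fin x.n, Function.Injective m ∧
      ∀ i, m i ∈ C ∧ ∀ o, a o ≠ m i := by
    have h1 : (Finset.univ.image a).card ≤ x.pairs.length * 2 := by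
      refine Finset.card_image_le.trans ?_
      simp
    have h2 : Fintype.card (Fin x.pairs.length) ≤
        Fintype.card (C \ Finset.univ.image a : Finset (Fin x.n)) := by
      rw [Fintype.card_coe, Fintype.card_fin]
      have := Finset.le_card_sdiff (Finset.univ.image a) C
      have hk' : 3 * x.pairs.length ≤ C.card := hk
      omega
    obtain ⟨m⟩ := Function.Embedding.nonempty_of_card_le h2
    refine ⟨fun i => m i, fun i j hij => m.injective (Subtype.ext hij), fun i => ?_⟩
    have := Finset.mem_sdiff.1 (m i).2
    exact ⟨this.1, fun o ho => this.2 (Finset.mem_image.2 ⟨o, Finset.mem_univ o, ho⟩)⟩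
  obtain ⟨m, hm, hmC⟩ := hmid
  rw [isYes_iff]
  refine routable_of_joined (fun i =>
    {e | ∃ b, x.terminal (i, b) ∉ C ∧ e = s(x.terminal (i, b), a (i, b))} ∪
      {e | ∃ b, e = s(a (i, b), m i)}) ?_ ?_ ?_
  · rintro i e (⟨b, hb, rfl⟩ | ⟨b, rfl⟩)
    · simp only [ha, hb, if_false]
      exact (g _ ⟨(i, b), rfl⟩).2
    · exact hC (haC _) (hmC i).1 ((hmC i).2 _)
  · intro i j hij
    rw [Set.disjoint_left]
    rintro e (⟨b, hb, rfl⟩ | ⟨b, rfl⟩) (⟨b', hb', he⟩ | ⟨b', he⟩)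
    · rw [Sym2.eq_iff] at he
      rcases he with ⟨h1, h2⟩ | ⟨h1, h2⟩
      · simp only [ha, hb, hb', if_false] at h2
        have := hgg _ _ h1 h2
        exact hij (congrArg Prod.fst this)
      · exact hb (h1 ▸ haC _)
    · rw [Sym2.eq_iff] at he
      rcases he with ⟨h1, h2⟩ | ⟨h1, h2⟩
      · exact hb (h1 ▸ haC _)
      · exact hb (h1 ▸ (hmC j).1)
    · rw [Sym2.eq_iff] at he
      rcases he with ⟨h1, h2⟩ | ⟨h1, h2⟩
      · exact hb' (h1 ▸ haC _)
      · exact hb' (h2 ▸ (hmC i).1)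
    · rw [Sym2.eq_iff] at he
      rcases he with ⟨h1, h2⟩ | ⟨h1, h2⟩
      · exact hij (hm h2)
      · exact (hmC j).2 _ h1
  · intro i
    have hside : ∀ b, Joined ({e | ∃ b, x.terminal (i, b) ∉ C ∧
        e = s(x.terminal (i, b), a (i, b))} ∪ {e | ∃ b, e = s(a (i, b), m i)})
        (x.terminal (i, b)) (m i) := by
      intro b
      have h2 : Joined ({e | ∃ b, x.terminal (i, b) ∉ C ∧
        e = s(x.terminal (i, b), a (i, b))} ∪ {e | ∃ b, e = s(a (i, b), m i)})
        (a (i, b)) (m i) := Joined.of_mem (.inr ⟨b, rfl⟩)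
      by_cases hb : x.terminal (i, b) ∈ C
      · have : a (i, b) = x.terminal (i, b) := by simp [ha, hb]
        rwa [this] at h2
      · exact (Joined.of_mem (.inl ⟨b, hb, rfl⟩)).trans h2
    exact (hside true).trans (hside false).symm

/-- The number of vertices of degree at least `d`. -/
noncomputable def numHigh (x : Instance) (d : ℕ) : ℕ :=
  (Finset.univ.filter fun v => d ≤ x.deg v).card

theorem exists_finset_of_isSplit {x : Instance} (h : x.IsSplit) :
    ∃ C : Finset (Fin x.n), x.graph.IsClique (C : Set (Fin x.n)) ∧
      x.graph.IsIndepSet (C : Set (Fin x.n))ᶜ := by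
  classical
  obtain ⟨C, hC, hI⟩ := h
  exact ⟨C.toFinset, by simpa using hC, by simpa using hI⟩

theorem le_card_of_lt_numHigh {x : Instance} {C : Finset (Fin x.n)}
    (hI : x.graph.IsIndepSet (C : Set (Fin x.n))ᶜ) {d : ℕ} (h : d < x.numHigh d) :
    d ≤ C.card := by
  classical
  by_contra! hlt
  have : x.numHigh d ≤ C.card := by
    refine Finset.card_le_card fun v hv => ?_
    by_contra hvC
    have hd : d ≤ x.deg v := by simpa using hv
    have : x.deg v ≤ C.card := Finset.card_le_card fun w hw => by
      have hw' : x.graph.Adj v w := by simpa using hw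
      exact mem_clique_of_adj hI hw' hvC
    omega
  omega

theorem card_le_of_numHigh_le {x : Instance} {C : Finset (Fin x.n)}
    (hC : x.graph.IsClique (C : Set (Fin x.n))) {d : ℕ} (h : x.numHigh d ≤ d) :
    C.card ≤ d := by
  classical
  by_contra! hlt
  have : C.card ≤ x.numHigh d := by
    refine Finset.card_le_card fun v hv => ?_
    have : (C.erase v).card ≤ x.deg v := Finset.card_le_card fun w hw => by
      have hw' := Finset.mem_erase.1 hw
      simpa using hC hv hw'.2 hw'.1.symm
    rw [Finset.card_erase_of_mem hv] at this
    simp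
    omega
  omega

/-- The trivial Yes-instance: one vertex and no terminal pairs. -/
def yesInstance : Instance := ⟨1, ⊥, [], by simp⟩

/-- A No-instance with one pair: two vertices that are not adjacent. -/
def noInstance₁ : Instance := ⟨2, ⊥, [(0, 1)], by simp⟩

/-- A No-instance with two pairs on a connected graph: a single edge, demanded twice. -/
def noInstance₂ : Instance := ⟨2, ⊤, [(0, 1), (0, 1)], by simp⟩

theorem encode_yesInstance : yesInstance.encode = [1, 0, 0] := by
  simp [encode, yesInstance, k, List.finRange_succ]

theorem encode_noInstance₁ : noInstance₁.encode = [2, 1, 0, 0, 0, 0, 0, 1] := by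
  simp [encode, noInstance₁, k, List.finRange_succ]

theorem encode_noInstance₂ : noInstance₂.encode = [2, 2, 0, 1, 1, 0, 0, 1, 0, 1] := by
  simp [encode, noInstance₂, k, List.finRange_succ]

theorem isSplit_yesInstance : yesInstance.IsSplit :=
  ⟨∅, by simp, fun _ _ _ _ _ h => h⟩

theorem isSplit_noInstance₁ : noInstance₁.IsSplit :=
  ⟨∅, by simp, fun _ _ _ _ _ h => h⟩

theorem isSplit_noInstance₂ : noInstance₂.IsSplit :=
  ⟨Set.univ, fun _ _ _ _ h => h, by simp⟩

theorem connected_yesInstance : yesInstance.graph.Connected := by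
  have : Subsingleton (Fin yesInstance.n) := inferInstanceAs (Subsingleton (Fin 1))
  have : Nonempty (Fin yesInstance.n) := ⟨(0 : Fin 1)⟩
  exact ⟨fun a b => by rw [Subsingleton.elim a b]⟩

theorem connected_noInstance₂ : noInstance₂.graph.Connected := by
  have : Nonempty (Fin noInstance₂.n) := ⟨(0 : Fin 2)⟩
  exact connected_top

theorem isYes_yesInstance : yesInstance.IsYes :=
  ⟨fun i => i.elim0, fun i => i.elim0⟩

theorem not_isYes_noInstance₁ : ¬ noInstance₁.IsYes := by
  rintro ⟨P, -⟩
  obtain ⟨w, hw, -⟩ := exists_mem_edges (P (0 : Fin 1)).1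
    (noInstance₁.ne_of_mem _ (List.get_mem _ _))
  exact hw

theorem not_isYes_noInstance₂ : ¬ noInstance₂.IsYes := by
  intro h
  have h1 := h.occ_le_deg (0 : Fin 2)
  have h2 : noInstance₂.occ (0 : Fin 2) = 2 := by decide
  have h3 : noInstance₂.deg (0 : Fin 2) ≤ 1 := by
    classical
    refine Finset.card_le_one.2 fun a ha b hb => ?_
    have ha' : (0 : Fin 2) ≠ a := (Finset.mem_filter.1 ha).2
    have hb' : (0 : Fin 2) ≠ b := (Finset.mem_filter.1 hb).2
    have key : ∀ a b : Fin 2, 0 ≠ a → 0 ≠ b → a = b := by decide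
    exact key a b ha' hb'
  omega

theorem not_connected_of_deg_eq_zero {x : Instance} {v : Fin x.n} (h : x.deg v = 0)
    (ho : x.occ v ≠ 0) : ¬ x.graph.Connected := by
  classical
  intro hconn
  obtain ⟨⟨i, b⟩, hi⟩ := Finset.card_ne_zero.1 ho
  have hi' : x.terminal (i, b) = v := by simpa using hi
  have hw : ∃ w, v ≠ w := by
    have := x.terminal_ne i
    cases b
    · exact ⟨x.terminal (i, true), by rw [← hi']; exact this.symm⟩
    · exact ⟨x.terminal (i, false), by rw [← hi']; exact this⟩
  obtain ⟨w, hvw⟩ := hw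
  obtain ⟨p⟩ := hconn.preconnected v w
  obtain ⟨u, hu, -⟩ := exists_mem_edges p hvw
  have : x.deg v ≠ 0 := Finset.card_ne_zero.2 ⟨u, by simpa using hu⟩
  exact this h

/-- `y` is the instance induced by `x` on the vertex set `K`, which is enumerated by `f`. -/
structure IsInduced (x y : Instance) (K : Set (Fin x.n)) (f : Fin y.n → Fin x.n) : Prop where
  injective : Function.Injective f
  range : ∀ v, v ∈ K ↔ ∃ i, f i = v
  graph : ∀ i j, y.graph.Adj i j ↔ x.graph.Adj (f i) (f j)
  pairs : x.pairs = y.pairs.map (Prod.map f f)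

namespace IsInduced

variable {x y : Instance} {K : Set (Fin x.n)} {f : Fin y.n → Fin x.n}

theorem length_eq (h : IsInduced x y K f) : x.pairs.length = y.pairs.length := by
  rw [h.pairs, List.length_map]

theorem terminal_eq (h : IsInduced x y K f) (i : Fin x.pairs.length) (b : Bool) :
    x.terminal (i, b) = f (y.terminal (Fin.cast h.length_eq i, b)) := by
  have : x.pairs.get i = Prod.map f f (y.pairs.get (Fin.cast h.length_eq i)) := by
    simp [h.pairs]
  cases b <;> simp only [terminal, this] <;> simp

theorem terminal_eq' (h : IsInduced x y K f) (i : Fin y.pairs.length) (b : Bool) :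
    f (y.terminal (i, b)) = x.terminal (Fin.cast h.length_eq.symm i, b) := by
  rw [h.terminal_eq]
  rfl

theorem isSplit (h : IsInduced x y K f) (hx : x.IsSplit) : y.IsSplit := by
  obtain ⟨C, hC, hI⟩ := hx
  refine ⟨f ⁻¹' C, fun a ha b hb hab => ?_, fun a ha b hb hab => ?_⟩
  · exact (h.graph a b).2 (hC ha hb (h.injective.ne hab))
  · exact fun hadj => hI ha hb (h.injective.ne hab) ((h.graph a b).1 hadj)

theorem isYes_of_isYes (h : IsInduced x y K f) (hy : y.IsYes) : x.IsYes := by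
  rw [isYes_iff] at hy ⊢
  obtain ⟨W, hW⟩ := hy
  let φ : y.graph →g x.graph := ⟨f, fun {a b} hab => (h.graph a b).1 hab⟩
  refine ⟨fun i => ((W (Fin.cast h.length_eq i)).map φ).copy
    (h.terminal_eq i true).symm (h.terminal_eq i false).symm, ?_⟩
  intro i j hij e he he'
  rw [Walk.edges_copy, Walk.edges_map, List.mem_map] at he he'
  obtain ⟨a, ha, rfl⟩ := he
  obtain ⟨b, hb, hab⟩ := he'
  have : b = a := Sym2.map.injective h.injective hab
  subst this
  exact hW _ _ (fun hc => hij (Fin.cast_injective _ hc)) ha hb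

theorem joined (h : IsInduced x y K f) {F : Set (Sym2 (Fin x.n))}
    (hF : F ⊆ (restrict x.graph K).edgeSet) {a b : Fin y.n} (hab : Joined F (f a) (f b)) :
    Joined (Sym2.map f ⁻¹' F) a b := by
  have key : ∀ z, Joined F (f a) z → ∃ c, f c = z ∧ Joined (Sym2.map f ⁻¹' F) a c := by
    intro z hz
    induction hz with
    | refl => exact ⟨a, rfl, .refl⟩
    | @tail u w _ huw ih =>
      obtain ⟨c, rfl, hc⟩ := ih
      obtain ⟨d, rfl⟩ := (h.range w).1 (hF huw).2.2
      exact ⟨d, rfl, hc.trans (Joined.of_mem (by simpa using huw))⟩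
  obtain ⟨c, hc, hac⟩ := key _ hab
  rwa [h.injective hc] at hac

theorem preimage_subset (h : IsInduced x y K f) :
    Sym2.map f ⁻¹' (restrict x.graph K).edgeSet ⊆ y.graph.edgeSet := by
  intro e he
  induction e with
  | _ a b => exact (h.graph a b).2 he.1

theorem isYes_of_routable (h : IsInduced x y K f)
    (hx : Routable (restrict x.graph K) (fun i => x.terminal (i, true))
      fun i => x.terminal (i, false)) : y.IsYes := by
  rw [isYes_iff]
  obtain ⟨W, hW⟩ := hx
  have hsub : ∀ i, {e | e ∈ (W i).edges} ⊆ (restrict x.graph K).edgeSet := fun i e he =>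
    (W i).edges_subset_edgeSet he
  refine routable_of_joined
    (fun i => Sym2.map f ⁻¹' {e | e ∈ (W (Fin.cast h.length_eq.symm i)).edges}) ?_ ?_ ?_
  · exact fun i e he => h.preimage_subset (hsub _ he)
  · intro i j hij
    rw [Set.disjoint_left]
    exact fun e he he' => hW _ _ (fun hc => hij (Fin.cast_injective _ hc)) he he'
  · intro i
    refine h.joined (hsub _) ?_
    rw [h.terminal_eq', h.terminal_eq']
    exact Joined.of_walk _

/-- The reduction is correct: if the vertices outside `K` are linked through sufficiently many
layers and `K` contains the terminals, then the induced instance on `K` is equivalent. -/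
theorem isYes_iff_isYes (h : IsInduced x y K f) {m : ℕ} {L : ℕ → Set (Fin x.n)}
    (hL : Layering x.graph m K L) {C : Finset (Fin x.n)}
    (hC : x.graph.IsClique (C : Set (Fin x.n))) (hI : x.graph.IsIndepSet (C : Set (Fin x.n))ᶜ)
    (hCk : C.card ≤ 4 * x.k) (hm : 10 * x.k * (Nat.sqrt x.k + 1) ≤ m)
    (hT : ∀ o, x.terminal o ∈ K) : x.IsYes ↔ y.IsYes := by
  refine ⟨fun hx => ?_, h.isYes_of_isYes⟩
  refine h.isYes_of_routable (hL.routable_restrict hC hI (r := Nat.sqrt x.k + 1) ?_ ?_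
    (fun i => hT _) (fun i => hT _) (x.isYes_iff.1 hx))
  · rw [Fintype.card_fin]
    exact Nat.lt_succ_sqrt x.k
  · rw [Fintype.card_fin]
    change C.card + x.k * (4 * (Nat.sqrt x.k + 1) + 2) ≤ m
    nlinarith [Nat.zero_le (x.k * Nat.sqrt x.k)]

theorem connected (h : IsInduced x y K f) {m : ℕ} {L : ℕ → Set (Fin x.n)}
    (hL : Layering x.graph m K L) {C : Finset (Fin x.n)}
    (hC : x.graph.IsClique (C : Set (Fin x.n))) (hI : x.graph.IsIndepSet (C : Set (Fin x.n))ᶜ)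
    (hCm : C.card + 1 ≤ m) (hK : K.Nonempty) (hx : x.graph.Connected) : y.graph.Connected := by
  obtain ⟨v, hv⟩ := hK
  obtain ⟨i, -⟩ := (h.range v).1 hv
  have : Nonempty (Fin y.n) := ⟨i⟩
  refine ⟨fun a b => ?_⟩
  obtain ⟨p⟩ := hx.preconnected (f a) (f b)
  have h1 : Joined x.graph.edgeSet (f a) (f b) :=
    (Joined.of_walk p).mono fun e he => p.edges_subset_edgeSet he
  have h2 := hL.joined_restrict hC hI hCm ((h.range _).2 ⟨a, rfl⟩) ((h.range _).2 ⟨b, rfl⟩) h1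
  obtain ⟨q, -⟩ := (h.joined subset_rfl h2).exists_walk h.preimage_subset
  exact ⟨q⟩

theorem k_eq (h : IsInduced x y K f) : y.k = x.k := h.length_eq.symm

theorem card_le (h : IsInduced x y K f) (S : Finset (Fin x.n)) (hS : ∀ v ∈ K, v ∈ S) :
    y.n ≤ S.card := by
  have := Finset.card_le_card_of_injOn (s := Finset.univ) (t := S) f
    (fun i _ => hS _ ((h.range _).2 ⟨i, rfl⟩)) h.injective.injOn
  simpa using this

end IsInduced

end Instance

end EDP

namespace EDP

/-! ### Reasoning about programs -/

namespace Program

/-- The registers that a program may write. -/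
def regs : Program → List ℕ
  | skip => []
  | assign r _ => [r]
  | store _ _ _ => []
  | seq p q => p.regs ++ q.regs
  | ite _ p q => p.regs ++ q.regs
  | loop _ p => p.regs

/-- The arrays that a program may write. -/
def arrs : Program → List ℕ
  | skip => []
  | assign _ _ => []
  | store a _ _ => [a]
  | seq p q => p.arrs ++ q.arrs
  | ite _ p q => p.arrs ++ q.arrs
  | loop _ p => p.arrs

/-- Run `p` with register `r` counting from `0` up to the value of `e`. -/
def forLoop (r : ℕ) (e : Expr) (p : Program) : Program :=
  seq (assign r (.const 0))
    (loop (.sub e (.reg r)) (seq p (assign r (.add (.reg r) (.const 1)))))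

end Program

theorem Exec.reg_eq {p : Program} {m m' : Memory} {t : ℕ} (h : Exec p m m' t) {r : ℕ}
    (hr : r ∉ p.regs) : m'.reg r = m.reg r := by
  induction h with
  | skip | store | loop_false => rfl
  | assign q e m =>
    simp only [Program.regs, List.mem_singleton] at hr
    exact Function.update_of_ne hr _ _
  | seq _ _ ih₁ ih₂ =>
    simp only [Program.regs, List.mem_append, not_or] at hr
    rw [ih₂ hr.2, ih₁ hr.1]
  | ite_true _ _ ih =>
    simp only [Program.regs, List.mem_append, not_or] at hr
    exact ih hr.1
  | ite_false _ _ ih =>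
    simp only [Program.regs, List.mem_append, not_or] at hr
    exact ih hr.2
  | loop_true _ _ _ ih₁ ih₂ => rw [ih₂ hr, ih₁ hr]

theorem Exec.arr_eq {p : Program} {m m' : Memory} {t : ℕ} (h : Exec p m m' t) {a : ℕ}
    (ha : a ∉ p.arrs) : m'.arr a = m.arr a := by
  induction h with
  | skip | assign | loop_false => rfl
  | store b i e m =>
    simp only [Program.arrs, List.mem_singleton] at ha
    exact Function.update_of_ne ha _ _
  | seq _ _ ih₁ ih₂ =>
    simp only [Program.arrs, List.mem_append, not_or] at ha
    rw [ih₂ ha.2, ih₁ ha.1]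
  | ite_true _ _ ih =>
    simp only [Program.arrs, List.mem_append, not_or] at ha
    exact ih ha.1
  | ite_false _ _ ih =>
    simp only [Program.arrs, List.mem_append, not_or] at ha
    exact ih ha.2
  | loop_true _ _ _ ih₁ ih₂ => rw [ih₂ ha, ih₁ ha]

/-- Started on memory `m`, the program `p` halts after at most `T` steps with arrays
satisfying `Q`. -/
def Runs (p : Program) (m : Memory) (T : ℕ) (Q : (ℕ → ℕ → ℕ) → Prop) : Prop :=
  ∃ (m' : Memory) (t : ℕ), Exec p m m' t ∧ t ≤ T ∧ Q m'.arr

namespace Runs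

variable {p q : Program} {m : Memory} {T T₁ T₂ : ℕ} {Q R : (ℕ → ℕ → ℕ) → Prop}

theorem mono (h : Runs p m T₁ R) (hT : T₁ ≤ T) (hQ : ∀ A, R A → Q A) : Runs p m T Q := by
  obtain ⟨m', t, he, ht, hR⟩ := h
  exact ⟨m', t, he, ht.trans hT, hQ _ hR⟩

/-- Arrays that the program does not write are unchanged. -/
theorem frame (h : Runs p m T Q) : Runs p m T fun A => Q A ∧ ∀ a ∉ p.arrs, A a = m.arr a := by
  obtain ⟨m', t, he, ht, hQ⟩ := h
  exact ⟨m', t, he, ht, hQ, fun a ha => he.arr_eq ha⟩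

theorem skip (h : Q m.arr) : Runs .skip m 1 Q :=
  ⟨_, _, .skip m, le_rfl, h⟩

theorem store {a : ℕ} {i e : Expr}
    (h : Q (Function.update m.arr a (Function.update (m.arr a) (i.eval m) (e.eval m)))) :
    Runs (.store a i e) m 1 Q :=
  ⟨_, _, .store a i e m, le_rfl, h⟩

theorem seq (hp : Runs p m T₁ R)
    (hq : ∀ m' : Memory, R m'.arr → (∀ a ∉ p.arrs, m'.arr a = m.arr a) →
      (∀ r ∉ p.regs, m'.reg r = m.reg r) → Runs q m' T₂ Q) :
    Runs (.seq p q) m (T₁ + T₂) Q := by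
  obtain ⟨m', t, he, ht, hR⟩ := hp
  obtain ⟨m'', t', he', ht', hQ⟩ :=
    hq m' hR (fun a ha => he.arr_eq ha) fun r hr => he.reg_eq hr
  exact ⟨m'', _, .seq he he', Nat.add_le_add ht ht', hQ⟩

theorem ite {e : Expr} (hp : e.eval m ≠ 0 → Runs p m T Q) (hq : e.eval m = 0 → Runs q m T Q) :
    Runs (.ite e p q) m (T + 1) Q := by
  by_cases h : e.eval m = 0
  · obtain ⟨m', t, he, ht, hQ⟩ := hq h
    exact ⟨m', _, .ite_false h he, Nat.succ_le_succ ht, hQ⟩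
  · obtain ⟨m', t, he, ht, hQ⟩ := hp h
    exact ⟨m', _, .ite_true h he, Nat.succ_le_succ ht, hQ⟩

/-- The invariant rule for counting loops. -/
theorem forLoop {r : ℕ} {e : Expr} {N : ℕ} (J : ℕ → (ℕ → ℕ → ℕ) → Prop) (hr : r ∉ p.regs)
    (he : ∀ m' : Memory, (∀ a ∉ p.arrs, m'.arr a = m.arr a) → e.eval m' = N) (h0 : J 0 m.arr)
    (hbody : ∀ i < N, ∀ m' : Memory, m'.reg r = i → (∀ q ∉ r :: p.regs, m'.reg q = m.reg q) →
      (∀ a ∉ p.arrs, m'.arr a = m.arr a) → J i m'.arr → Runs p m' T (J (i + 1))) :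
    Runs (Program.forLoop r e p) m (N * (T + 2) + 2) (J N) := by
  have key : ∀ c i, i + c = N → ∀ m' : Memory, m'.reg r = i →
      (∀ q ∉ r :: p.regs, m'.reg q = m.reg q) → (∀ a ∉ p.arrs, m'.arr a = m.arr a) →
      J i m'.arr →
      Runs (.loop (.sub e (.reg r)) (.seq p (.assign r (.add (.reg r) (.const 1))))) m'
        (c * (T + 2) + 1) (J N) := by
    intro c
    induction c with
    | zero =>
      intro i hi m' hri _ harr hJ
      refine ⟨m', 1, .loop_false ?_, by omega, ?_⟩
      · simp [Expr.eval, he m' harr, hri]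
        omega
      · rwa [← hi]
    | succ c ih =>
      intro i hi m' hri hreg harr hJ
      obtain ⟨m'', t, hx, ht, hJ'⟩ := hbody i (by omega) m' hri hreg harr hJ
      have hr'' : m''.reg r = i := by rw [hx.reg_eq hr, hri]
      obtain ⟨m₃, t', hx', ht', hQ⟩ := ih (i + 1) (by omega)
        ⟨Function.update m''.reg r (i + 1), m''.arr⟩ (by simp)
        (by
          intro q hq
          rw [List.mem_cons, not_or] at hq
          simp only [Function.update_of_ne hq.1]
          rw [hx.reg_eq hq.2]
          exact hreg q (by simp [hq]))
        (fun a ha => by rw [hx.arr_eq ha, harr a ha]) hJ'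
      have hstep := Exec.assign r (.add (.reg r) (.const 1)) m''
      simp only [Expr.eval, hr''] at hstep
      refine ⟨m₃, _, .loop_true ?_ (.seq hx hstep) hx', ?_, hQ⟩
      · simp [Expr.eval, he m' harr, hri]
        omega
      · rw [Nat.succ_mul]
        omega
  obtain ⟨m', t, hx, ht, hQ⟩ := key N 0 (by omega) ⟨Function.update m.reg r 0, m.arr⟩ (by simp)
    (by
      intro q hq
      rw [List.mem_cons, not_or] at hq
      simp [Function.update_of_ne hq.1])
    (fun _ _ => rfl) h0
  refine ⟨m', _, .seq (.assign r (.const 0) m) hx, by omega, hQ⟩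

end Runs

/-! ### Access to the input -/

/-- The array `a` begins with the encoding of `x`. -/
structure IsInput (x : Instance) (a : ℕ → ℕ) : Prop where
  n_eq : a 0 = x.n
  k_eq : a 1 = x.k
  adj_ne_zero : ∀ i j : Fin x.n, a (2 + x.n * i + j) ≠ 0 ↔ x.graph.Adj i j
  adj_le_one : ∀ i j : Fin x.n, a (2 + x.n * i + j) ≤ 1
  fst_eq : ∀ p : Fin x.pairs.length, a (2 + x.n * x.n + (p + p)) = x.terminal (p, true)
  snd_eq : ∀ p : Fin x.pairs.length, a (2 + x.n * x.n + (p + p) + 1) = x.terminal (p, false)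

theorem getD_flatMap_add {α : Type*} (l : List α) (g : α → List ℕ) {c : ℕ}
    (hc : ∀ b ∈ l, (g b).length = c) (l' : List ℕ) {i j : ℕ} (hi : i < l.length) (hj : j < c) :
    (l.flatMap g ++ l').getD (c * i + j) 0 = (g l[i]).getD j 0 := by
  induction l generalizing i with
  | nil => simp at hi
  | cons b l ih =>
    have hb := hc b (by simp)
    rw [List.flatMap_cons, List.append_assoc]
    cases i with
    | zero =>
      rw [List.getD_append _ _ _ _ (by omega)]
      simp
    | succ i =>
      rw [List.getD_append_right _ _ _ _ (by rw [hb]; nlinarith)]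
      rw [show c * (i + 1) + j - (g b).length = c * i + j by rw [hb]; ring_nf; omega]
      rw [ih (fun b hb => hc b (by simp [hb])) (by simpa using hi)]
      simp

theorem isInput_encode (x : Instance) : IsInput x fun i => x.encode.getD i 0 := by
  classical
  have hlen : ((List.finRange x.n).flatMap fun i => (List.finRange x.n).map fun j =>
      if x.graph.Adj i j then (1 : ℕ) else 0).length = x.n * x.n := by
    simp [List.length_flatMap]
  have hadj : ∀ i j : Fin x.n, x.encode.getD (2 + x.n * i + j) 0 =
      if x.graph.Adj i j then 1 else 0 := by
    intro i j
    have h := getD_flatMap_add (List.finRange x.n) (fun i => (List.finRange x.n).map fun j =>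
      if x.graph.Adj i j then (1 : ℕ) else 0) (c := x.n) (by simp)
      (x.pairs.flatMap fun p => [(p.1 : ℕ), (p.2 : ℕ)]) (i := i) (j := j) (by simp) j.2
    rw [Instance.encode, List.append_assoc, List.getD_append_right _ _ _ _ (by simp; omega)]
    rw [show 2 + x.n * (i : ℕ) + j - [x.n, x.k].length = x.n * i + j by simp; omega]
    convert h using 1
    simp [List.getD_eq_getElem?_getD]
  have hpair : ∀ (p : Fin x.pairs.length) (j : ℕ), j < 2 →
      x.encode.getD (2 + x.n * x.n + (p + p) + j) 0 =
        [((x.pairs.get p).1 : ℕ), ((x.pairs.get p).2 : ℕ)].getD j 0 := by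
    intro p j hj
    have h := getD_flatMap_add x.pairs (fun p => [(p.1 : ℕ), (p.2 : ℕ)]) (c := 2) (by simp)
      [] (i := p) (j := j) p.2 hj
    rw [Instance.encode, List.getD_append_right _ _ _ _ (by
      rw [List.length_append, hlen]; simp; omega)]
    rw [List.length_append, hlen]
    rw [show 2 + x.n * x.n + ((p : ℕ) + p) + j - ([x.n, x.k].length + x.n * x.n) = 2 * p + j by
      simp; omega]
    simpa using h
  refine ⟨by simp [Instance.encode], by simp [Instance.encode], fun i j => ?_, fun i j => ?_,
    fun p => ?_, fun p => ?_⟩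
  · rw [hadj]
    split_ifs with h <;> simp [h]
  · rw [hadj]
    split_ifs <;> simp
  · have := hpair p 0 (by omega)
    simpa [Instance.terminal] using this
  · have := hpair p 1 (by omega)
    simpa [Instance.terminal] using this

/-- Array `0` holds the input, and `arr 2 i` is the position in it of row `i` of the adjacency
matrix. -/
structure Ready (x : Instance) (A : ℕ → ℕ → ℕ) : Prop where
  input : IsInput x (A 0)
  row : ∀ i ≤ x.n, A 2 i = 2 + x.n * i

theorem Ready.congr {x : Instance} {A A' : ℕ → ℕ → ℕ} (h : Ready x A) (h₀ : A' 0 = A 0)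
    (h₂ : A' 2 = A 2) : Ready x A' :=
  ⟨h₀ ▸ h.input, h₂ ▸ h.row⟩

namespace Expr

/-- the number of vertices -/
def numVert : Expr := .cell 0 (.const 0)

/-- the parameter -/
def param : Expr := .cell 0 (.const 1)

/-- the entry of the adjacency matrix -/
def adj (i j : Expr) : Expr := .cell 0 (.add (.cell 2 i) j)

/-- the first vertex of a terminal pair -/
def fst (p : Expr) : Expr := .cell 0 (.add (.cell 2 numVert) (.add p p))

/-- the second vertex of a terminal pair -/
def snd (p : Expr) : Expr := .cell 0 (.add (.add (.cell 2 numVert) (.add p p)) (.const 1))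

/-- the multiple of an expression by a fixed number -/
def times : ℕ → Expr → Expr
  | 0, _ => .const 0
  | c + 1, e => .add (times c e) e

/-- the distance of two numbers, which is nonzero if and only if they differ -/
def dist (e₁ e₂ : Expr) : Expr := .add (.sub e₁ e₂) (.sub e₂ e₁)

theorem eval_times (m : Memory) (c : ℕ) (e : Expr) : (times c e).eval m = c * e.eval m := by
  induction c with
  | zero => simp [times, eval]
  | succ c ih => rw [times, eval, ih, Nat.succ_mul]

theorem eval_dist_eq_zero (m : Memory) (e₁ e₂ : Expr) :
    (dist e₁ e₂).eval m = 0 ↔ e₁.eval m = e₂.eval m := by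
  simp only [dist, eval]
  omega

end Expr

section Eval

variable {x : Instance} {m : Memory}

theorem Ready.eval_numVert (h : Ready x m.arr) : Expr.numVert.eval m = x.n := h.input.n_eq

theorem Ready.eval_param (h : Ready x m.arr) : Expr.param.eval m = x.k := h.input.k_eq

theorem Ready.eval_adj_ne_zero (h : Ready x m.arr) {e₁ e₂ : Expr} {v w : Fin x.n}
    (hv : e₁.eval m = v) (hw : e₂.eval m = w) : (Expr.adj e₁ e₂).eval m ≠ 0 ↔ x.graph.Adj v w := by
  simp only [Expr.adj, Expr.eval, hv, hw, h.row v v.2.le]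
  exact h.input.adj_ne_zero v w

theorem Ready.eval_adj_le_one (h : Ready x m.arr) {e₁ e₂ : Expr} {v w : Fin x.n}
    (hv : e₁.eval m = v) (hw : e₂.eval m = w) : (Expr.adj e₁ e₂).eval m ≤ 1 := by
  simp only [Expr.adj, Expr.eval, hv, hw, h.row v v.2.le]
  exact h.input.adj_le_one v w

open Classical in
theorem Ready.eval_adj (h : Ready x m.arr) {e₁ e₂ : Expr} {v w : Fin x.n}
    (hv : e₁.eval m = v) (hw : e₂.eval m = w) :
    (Expr.adj e₁ e₂).eval m = if x.graph.Adj v w then 1 else 0 := by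
  have h1 := h.eval_adj_ne_zero hv hw
  have h2 := h.eval_adj_le_one hv hw
  split_ifs with hadj
  · have := h1.2 hadj
    omega
  · by_contra h3
    exact hadj (h1.1 h3)

theorem Ready.eval_fst (h : Ready x m.arr) {e : Expr} {p : Fin x.pairs.length}
    (hp : e.eval m = p) : (Expr.fst e).eval m = x.terminal (p, true) := by
  simp only [Expr.fst, Expr.eval, h.eval_numVert, h.row x.n le_rfl, hp]
  exact h.input.fst_eq p

theorem Ready.eval_snd (h : Ready x m.arr) {e : Expr} {p : Fin x.pairs.length}
    (hp : e.eval m = p) : (Expr.snd e).eval m = x.terminal (p, false) := by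
  simp only [Expr.snd, Expr.eval, h.eval_numVert, h.row x.n le_rfl, hp]
  exact h.input.snd_eq p

end Eval

end EDP

namespace EDP

open Program

/-! ### Degrees, occurrences and the number of layers -/

/-- The positions of the rows of the adjacency matrix. -/
def computeRows : Program :=
  .seq (.store 2 (.const 0) (.const 2))
    (forLoop 1 .numVert
      (.store 2 (.add (.reg 1) (.const 1)) (.add (.cell 2 (.reg 1)) .numVert)))

/-- `arr 3 v` becomes the degree of `v`. -/
def computeDegrees : Program :=
  forLoop 1 .numVert (forLoop 2 .numVert
    (.store 3 (.reg 1) (.add (.cell 3 (.reg 1)) (.adj (.reg 1) (.reg 2)))))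

/-- `arr 4 v` becomes the number of occurrences of `v` in the terminal pairs. -/
def computeOccurrences : Program :=
  forLoop 1 .param (.seq
    (.store 4 (.fst (.reg 1)) (.add (.cell 4 (.fst (.reg 1))) (.const 1)))
    (.store 4 (.snd (.reg 1)) (.add (.cell 4 (.snd (.reg 1))) (.const 1))))

/-- `arr 5 0` becomes the number of vertices of degree at least `4 * k`. -/
def countHigh : Program :=
  forLoop 1 .numVert (.ite (.sub (.add (.cell 3 (.reg 1)) (.const 1)) (.times 4 .param))
    (.store 5 (.const 0) (.add (.cell 5 (.const 0)) (.const 1))) .skip)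

/-- `arr 6 0` becomes nonzero if some vertex has more occurrences than neighbours. -/
def checkDegrees : Program :=
  forLoop 1 .numVert (.ite (.sub (.cell 4 (.reg 1)) (.cell 3 (.reg 1)))
    (.store 6 (.const 0) (.const 1)) .skip)

/-- `arr 9 0` becomes `Nat.sqrt k + 1`; the squares are computed in array `8`. -/
def computeSqrt : Program :=
  forLoop 1 (.add .param (.const 1)) (.seq
    (.ite (.sub (.add .param (.const 1)) (.cell 8 (.reg 1)))
      (.store 9 (.const 0) (.add (.cell 9 (.const 0)) (.const 1))) .skip)
    (.store 8 (.add (.reg 1) (.const 1))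
      (.add (.cell 8 (.reg 1)) (.add (.add (.reg 1) (.reg 1)) (.const 1)))))

/-- `arr 10 0` becomes the number of layers. -/
def computeNumLayers : Program :=
  forLoop 1 (.cell 9 (.const 0))
    (.store 10 (.const 0) (.add (.cell 10 (.const 0)) (.times 10 .param)))

section

variable {x : Instance} {m : Memory}

theorem runs_computeRows (h : IsInput x (m.arr 0)) :
    Runs computeRows m (x.n * 3 + 3) fun A => Ready x A := by
  have h1 : Runs computeRows m (1 + (x.n * 3 + 2)) fun A => ∀ i ≤ x.n, A 2 i = 2 + x.n * i := by
    refine Runs.seq (R := fun A => A 2 0 = 2) (Runs.store (by simp [Expr.eval])) ?_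
    intro m' h2 hA _
    have hn : ∀ m'' : Memory, (∀ a ∉ [2], m''.arr a = m'.arr a) →
        Expr.numVert.eval m'' = x.n := by
      intro m'' h''
      simp only [Expr.numVert, Expr.eval]
      rw [h'' 0 (by decide), hA 0 (by decide)]
      exact h.n_eq
    refine Runs.forLoop (T := 1) (fun j A => ∀ i ≤ j, A 2 i = 2 + x.n * i) (by decide) hn ?_ ?_
    · intro i hi
      simpa [Nat.le_zero.1 hi] using h2
    · intro j hj m'' hr _ hA'' hJ
      refine Runs.store ?_
      intro i hi
      simp only [Expr.eval, hr, Function.update_self, hn m'' hA'', Function.update_apply]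
      split_ifs with hij
      · rw [hJ j le_rfl, hij]
        ring
      · exact hJ i (by omega)
  refine h1.frame.mono (by omega) fun A hA => ⟨?_, hA.1⟩
  rw [hA.2 0 (by decide)]
  exact h

theorem card_filter_lt_succ {N : ℕ} (P : Fin N → Prop) [DecidablePred P] (i : Fin N) :
    (Finset.univ.filter fun w : Fin N => (w : ℕ) < i + 1 ∧ P w).card =
      (Finset.univ.filter fun w : Fin N => (w : ℕ) < i ∧ P w).card + if P i then 1 else 0 := by
  have h : (Finset.univ.filter fun w : Fin N => (w : ℕ) < i + 1 ∧ P w) =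
      (Finset.univ.filter fun w : Fin N => (w : ℕ) < i ∧ P w) ∪
        if P i then {i} else ∅ := by
    ext w
    by_cases hi : P i
    · simp only [Finset.mem_filter, Finset.mem_univ, true_and, Finset.mem_union, hi, if_true,
        Finset.mem_singleton]
      constructor
      · rintro ⟨h1, h2⟩
        by_cases hw : w = i
        · exact .inr hw
        · have : (w : ℕ) ≠ i := fun h => hw (Fin.ext h)
          exact .inl ⟨by omega, h2⟩
      · rintro (⟨h1, h2⟩ | rfl)
        · exact ⟨by omega, h2⟩
        · exact ⟨by omega, hi⟩
    · simp only [Finset.mem_filter, Finset.mem_univ, true_and, Finset.mem_union, hi, if_false,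
        Finset.notMem_empty, or_false]
      constructor
      · rintro ⟨h1, h2⟩
        have : (w : ℕ) ≠ i := fun h => hi (Fin.ext h ▸ h2)
        exact ⟨by omega, h2⟩
      · rintro ⟨h1, h2⟩
        exact ⟨by omega, h2⟩
  rw [h, Finset.card_union_of_disjoint]
  · split_ifs <;> simp
  · rw [Finset.disjoint_left]
    intro w hw hw'
    split_ifs at hw' with hi
    · rw [Finset.mem_singleton] at hw'
      subst hw'
      simp at hw
    · simp at hw'

theorem runs_computeDegrees (h : Ready x m.arr) (h3 : ∀ v, m.arr 3 v = 0) :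
    Runs computeDegrees m (x.n * (x.n * 3 + 4) + 2) fun A => ∀ v : Fin x.n, A 3 v = x.deg v := by
  classical
  refine (Runs.forLoop (T := x.n * 3 + 2) (fun i A => ∀ v : Fin x.n,
    A 3 v = if (v : ℕ) < i then x.deg v else 0) (by decide)
    (fun m' h' => (h.congr (h' 0 (by decide)) (h' 2 (by decide))).eval_numVert)
    (fun v => h3 v) ?_).mono le_rfl fun A hA v => (hA v).trans (if_pos v.2)
  intro i hi m' hri _ hA' hJ
  set u : Fin x.n := ⟨i, hi⟩ with hu
  have hr' := h.congr (hA' 0 (by decide)) (hA' 2 (by decide))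
  refine (Runs.forLoop (T := 1) (fun j A => A 3 u =
      (Finset.univ.filter fun w : Fin x.n => (w : ℕ) < j ∧ x.graph.Adj u w).card ∧
      ∀ v : Fin x.n, v ≠ u → A 3 v = m'.arr 3 v) (by decide)
    (fun m'' h'' => (hr'.congr (h'' 0 (by decide)) (h'' 2 (by decide))).eval_numVert)
    ⟨?_, fun _ _ => rfl⟩ ?_).mono (by omega) ?_
  · rw [hJ u]
    simp [hu]
  · intro j hj m'' hrj hreg hA'' hJ'
    have hr'' := hr'.congr (hA'' 0 (by decide)) (hA'' 2 (by decide))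
    have hri' : m''.reg 1 = i := by rw [hreg 1 (by decide), hri]
    have hadj := hr''.eval_adj (e₁ := .reg 1) (e₂ := .reg 2) (v := u) (w := ⟨j, hj⟩)
      (by simp [Expr.eval, hri', hu]) (by simp [Expr.eval, hrj])
    refine Runs.store ⟨?_, fun v hv => ?_⟩
    · simp only [Expr.eval] at hadj ⊢
      rw [card_filter_lt_succ (fun w => x.graph.Adj u w) ⟨j, hj⟩]
      simp only [Function.update_self, hri', hadj]
      have := hJ'.1
      simp only [hu] at this ⊢
      rw [Function.update_self, this]
    · have : (v : ℕ) ≠ i := fun h => hv (Fin.ext h)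
      simp only [Expr.eval, Function.update_self, hri', Function.update_of_ne this]
      exact hJ'.2 v hv
  · rintro A ⟨h1, h2⟩ v
    by_cases hv : v = u
    · rw [hv, h1, if_pos (by simp [hu]), Instance.deg]
      congr 1
      ext w
      simp
    · have hv' : (v : ℕ) ≠ i := fun h => hv (Fin.ext h)
      rw [h2 v hv, hJ v]
      by_cases hlt : (v : ℕ) < i
      · rw [if_pos hlt, if_pos (by omega)]
      · rw [if_neg hlt, if_neg (by omega)]

/-- The number of occurrences of `v` in the first `p` terminal pairs. -/
def occBefore (x : Instance) (p : ℕ) (v : Fin x.n) : ℕ :=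
  (Finset.univ.filter fun q : Fin x.pairs.length => (q : ℕ) < p ∧ x.terminal (q, true) = v).card +
  (Finset.univ.filter fun q : Fin x.pairs.length => (q : ℕ) < p ∧ x.terminal (q, false) = v).card

theorem occBefore_k (x : Instance) (v : Fin x.n) : occBefore x x.k v = x.occ v := by
  have h : ∀ b, (Finset.univ.filter fun q : Fin x.pairs.length =>
      (q : ℕ) < x.k ∧ x.terminal (q, b) = v).card =
      ∑ q : Fin x.pairs.length, if x.terminal (q, b) = v then 1 else 0 := by
    intro b
    rw [Finset.card_filter]
    refine Finset.sum_congr rfl fun q _ => ?_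
    have : (q : ℕ) < x.k := q.2
    simp [this]
  rw [occBefore, h, h, Instance.occ, Finset.card_filter, Fintype.sum_prod_type,
    ← Finset.sum_add_distrib]
  simp only [Fintype.sum_bool]

theorem runs_computeOccurrences (h : Ready x m.arr) (h4 : ∀ v, m.arr 4 v = 0) :
    Runs computeOccurrences m (x.k * 4 + 2) fun A => ∀ v : Fin x.n, A 4 v = x.occ v := by
  classical
  refine (Runs.forLoop (T := 2) (fun p A => ∀ v : Fin x.n, A 4 v = occBefore x p v) (by decide)
    (fun m' h' => (h.congr (h' 0 (by decide)) (h' 2 (by decide))).eval_param) ?_ ?_).mono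
    le_rfl fun A hA v => (hA v).trans (occBefore_k x v)
  · intro v
    rw [h4]
    simp [occBefore]
  · intro p hp m' hrp hreg hA' hJ
    set q : Fin x.pairs.length := ⟨p, hp⟩ with hq
    have hr' := h.congr (hA' 0 (by decide)) (hA' 2 (by decide))
    refine Runs.seq (T₁ := 1) (T₂ := 1) (R := fun A => ∀ v : Fin x.n,
      A 4 v = occBefore x p v + if x.terminal (q, true) = v then 1 else 0) ?_ ?_
    · refine Runs.store fun v => ?_
      have hf := hr'.eval_fst (e := .reg 1) (p := q) (by simp [Expr.eval, hrp, hq])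
      simp only [Expr.eval, hf, Function.update_self, Function.update_apply]
      by_cases hv : x.terminal (q, true) = v
      · simp [hv, hJ v]
      · have : (v : ℕ) ≠ x.terminal (q, true) := fun h => hv (Fin.ext h.symm)
        simp [hv, this, hJ v]
    · intro m'' hR hA'' hreg''
      have hr'' := hr'.congr (hA'' 0 (by decide)) (hA'' 2 (by decide))
      have hrp'' : m''.reg 1 = p := by rw [hreg'' 1 (by decide), hrp]
      refine Runs.store fun v => ?_
      have hf := hr''.eval_snd (e := .reg 1) (p := q) (by simp [Expr.eval, hrp'', hq])
      have hsucc : occBefore x (p + 1) v = occBefore x p v +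
          (if x.terminal (q, true) = v then 1 else 0) +
          if x.terminal (q, false) = v then 1 else 0 := by
        have e1 := card_filter_lt_succ (fun r => x.terminal (r, true) = v) q
        have e2 := card_filter_lt_succ (fun r => x.terminal (r, false) = v) q
        simp only [hq] at e1 e2
        simp only [occBefore]
        rw [e1, e2]
        ring
      rw [hsucc]
      simp only [Expr.eval, hf, Function.update_self, Function.update_apply]
      by_cases hv : x.terminal (q, false) = v
      · simp [hv, hR v]
      · have : (v : ℕ) ≠ x.terminal (q, false) := fun h => hv (Fin.ext h.symm)
        simp [hv, this, hR v]

theorem runs_countHigh (h : Ready x m.arr) (h3 : ∀ v : Fin x.n, m.arr 3 v = x.deg v)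
    (h5 : m.arr 5 0 = 0) :
    Runs countHigh m (x.n * 4 + 2) fun A => A 5 0 = x.numHigh (4 * x.k) := by
  classical
  refine (Runs.forLoop (T := 2) (fun i A => A 5 0 =
    (Finset.univ.filter fun v : Fin x.n => (v : ℕ) < i ∧ 4 * x.k ≤ x.deg v).card) (by decide)
    (fun m' h' => (h.congr (h' 0 (by decide)) (h' 2 (by decide))).eval_numVert) ?_ ?_).mono
    le_rfl fun A hA => hA.trans ?_
  · simp [h5]
  · intro i hi m' hri hreg hA' hJ
    have hr' := h.congr (hA' 0 (by decide)) (hA' 2 (by decide))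
    have hdeg : m'.arr 3 i = x.deg ⟨i, hi⟩ := by
      rw [hA' 3 (by decide)]
      exact h3 ⟨i, hi⟩
    have hsucc := card_filter_lt_succ (fun v => 4 * x.k ≤ x.deg v) ⟨i, hi⟩
    simp only at hsucc
    refine Runs.ite (fun he => Runs.store ?_) fun he => Runs.skip ?_
    · simp only [Expr.eval, hri, hdeg, Expr.eval_times, hr'.eval_param] at he
      simp only [Expr.eval, Function.update_self, hJ, hsucc]
      rw [if_pos (by omega)]
    · simp only [Expr.eval, hri, hdeg, Expr.eval_times, hr'.eval_param] at he
      rw [hJ, hsucc, if_neg (by omega), add_zero]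
  · rw [Instance.numHigh]
    congr 1
    ext v
    simp

theorem runs_checkDegrees (h : Ready x m.arr) (h3 : ∀ v : Fin x.n, m.arr 3 v = x.deg v)
    (h4 : ∀ v : Fin x.n, m.arr 4 v = x.occ v) (h6 : m.arr 6 0 = 0) :
    Runs checkDegrees m (x.n * 4 + 2) fun A => A 6 0 ≠ 0 ↔ ∃ v, x.deg v < x.occ v := by
  refine (Runs.forLoop (T := 2) (fun i A => A 6 0 ≠ 0 ↔
    ∃ v : Fin x.n, (v : ℕ) < i ∧ x.deg v < x.occ v) (by decide)
    (fun m' h' => (h.congr (h' 0 (by decide)) (h' 2 (by decide))).eval_numVert) ?_ ?_).mono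
    le_rfl fun A hA => hA.trans ?_
  · simp [h6]
  · intro i hi m' hri hreg hA' hJ
    have hdeg : m'.arr 3 i = x.deg ⟨i, hi⟩ := by
      rw [hA' 3 (by decide)]
      exact h3 ⟨i, hi⟩
    refine Runs.ite (fun he => Runs.store ?_) fun he => Runs.skip ?_
    · have hocc : m.arr 4 i = x.occ ⟨i, hi⟩ := h4 ⟨i, hi⟩
      simp only [Expr.eval, hri, hdeg, hA' 4 (by decide), hocc] at he
      simp only [Expr.eval, Function.update_self]
      exact iff_of_true one_ne_zero ⟨⟨i, hi⟩, Nat.lt_succ_self i, by omega⟩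
    · have hocc : m.arr 4 i = x.occ ⟨i, hi⟩ := h4 ⟨i, hi⟩
      simp only [Expr.eval, hri, hdeg, hA' 4 (by decide), hocc] at he
      rw [hJ]
      constructor
      · rintro ⟨v, hv, hlt⟩
        exact ⟨v, by omega, hlt⟩
      · rintro ⟨v, hv, hlt⟩
        refine ⟨v, ?_, hlt⟩
        by_contra hvi
        have : v = ⟨i, hi⟩ := Fin.ext (by simp only; omega)
        subst this
        omega
  · simp

theorem runs_computeSqrt (h : Ready x m.arr) (h8 : m.arr 8 0 = 0) (h9 : m.arr 9 0 = 0) :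
    Runs computeSqrt m ((x.k + 1) * 5 + 2) fun A => A 9 0 = Nat.sqrt x.k + 1 := by
  have hk : ∀ m' : Memory, (∀ a ∉ [9, 8], m'.arr a = m.arr a) → Expr.param.eval m' = x.k :=
    fun m' h' => (h.congr (h' 0 (by decide)) (h' 2 (by decide))).eval_param
  have hsq : Nat.sqrt x.k ≤ x.k := Nat.sqrt_le_self x.k
  refine (Runs.forLoop (T := 3) (fun i A => A 8 i = i * i ∧ A 9 0 = min i (Nat.sqrt x.k + 1))
    (by decide) (N := x.k + 1) (fun m' h' => by simp only [Expr.eval, hk m' h']) ?_ ?_).mono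
    le_rfl fun A hA => hA.2.trans (by omega)
  · simp [h8, h9]
  · intro i hi m' hri hreg hA' hJ
    have hkm := hk m' hA'
    refine Runs.seq (T₁ := 2) (T₂ := 1)
      (R := fun A => A 9 0 = min (i + 1) (Nat.sqrt x.k + 1)) ?_ ?_
    · have hle : i * i ≤ x.k ↔ i ≤ Nat.sqrt x.k := Nat.le_sqrt.symm
      refine Runs.ite (fun he => Runs.store ?_) fun he => Runs.skip ?_
      · simp only [Expr.eval, hri, hJ.1, hkm] at he
        have := hle.1 (by omega)
        simp only [Expr.eval, Function.update_self, hJ.2]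
        omega
      · simp only [Expr.eval, hri, hJ.1, hkm] at he
        have : ¬ i ≤ Nat.sqrt x.k := fun h => by
          have := hle.2 h
          omega
        rw [hJ.2]
        omega
    · intro m'' hR hA'' hreg''
      have hr'' : m''.reg 1 = i := by rw [hreg'' 1 (by decide), hri]
      refine Runs.store ⟨?_, ?_⟩
      · simp only [Expr.eval, hr'', Function.update_self, hA'' 8 (by decide), hJ.1]
        ring
      · simpa [Expr.eval] using hR

theorem runs_computeNumLayers (h : Ready x m.arr) (h9 : m.arr 9 0 = Nat.sqrt x.k + 1)
    (h10 : m.arr 10 0 = 0) :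
    Runs computeNumLayers m ((Nat.sqrt x.k + 1) * 3 + 2)
      fun A => A 10 0 = 10 * x.k * (Nat.sqrt x.k + 1) := by
  refine Runs.forLoop (T := 1) (fun i A => A 10 0 = 10 * x.k * i) (by decide)
    (fun m' h' => by simp only [Expr.eval, h' 9 (by decide), h9]) (by simpa using h10) ?_
  intro i hi m' hri hreg hA' hJ
  have hr' := h.congr (hA' 0 (by decide)) (hA' 2 (by decide))
  refine Runs.store ?_
  simp only [Expr.eval, Function.update_self, hJ, Expr.eval_times, hr'.eval_param]
  ring

end

end EDP

namespace EDP

open Program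

/-! ### Choosing the layers -/

section Round

variable {V : Type*} {G : SimpleGraph V}

theorem Linked.mono {S S' : Set V} (h : S ⊆ S') {a b : V} (hab : Linked G S a b) :
    Linked G S' a b :=
  Relation.EqvGen.mono (fun _ _ ⟨c, hc, h'⟩ => ⟨c, h hc, h'⟩) _ _ hab

/-- Replace the label `q` by the label `p`. -/
def relabel (lab : V → ℕ) (p q : ℕ) : V → ℕ := fun z => if lab z = q then p else lab z

/-- The state of the construction of a layer `K \ K₀`. Vertices with the same label are linked
through the layer, and each vertex of the layer outside a vertex cover `C` has decreased the number
of labels on `C`. -/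
structure IsRound (G : SimpleGraph V) (K₀ K : Set V) (lab : V → ℕ) : Prop where
  subset : K₀ ⊆ K
  linked : ∀ a b, lab a = lab b → Linked G (K \ K₀) a b
  card_le : ∀ C : Finset V, G.IsIndepSet (C : Set V)ᶜ →
    ((K \ K₀) \ C).ncard + (C.image lab).card ≤ C.card

theorem IsRound.init (K : Set V) {lab : V → ℕ} (h : Function.Injective lab) :
    IsRound G K K lab where
  subset := subset_rfl
  linked a b hab := by
    rw [h hab]
    exact .refl b
  card_le C _ := by simpa using Finset.card_image_le

theorem IsRound.insert [Finite V] {K₀ K : Set V} {lab : V → ℕ} (h : IsRound G K₀ K lab)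
    {v a b : V} (hv : v ∉ K₀) (ha : G.Adj v a) (hb : G.Adj v b) (hab : lab a ≠ lab b) :
    IsRound G K₀ (insert v K) (relabel lab (lab a) (lab b)) where
  subset := h.subset.trans (Set.subset_insert v K)
  linked c d hcd := by
    have hold : ∀ c d, lab c = lab d → Linked G (Insert.insert v K \ K₀) c d := fun c d hcd =>
      (h.linked c d hcd).mono (Set.sdiff_subset_sdiff_left (Set.subset_insert v K))
    have hnew : Linked G (Insert.insert v K \ K₀) a b :=
      .rel _ _ ⟨v, ⟨Set.mem_insert v K, hv⟩, ha, hb⟩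
    unfold relabel at hcd
    split_ifs at hcd with hc hd hd
    · exact hold c d (hc.trans hd.symm)
    · exact ((hold c b hc).trans _ _ _ (hnew.symm _ _)).trans _ _ _ (hold a d hcd)
    · exact ((hold c a hcd).trans _ _ _ hnew).trans _ _ _ (hold b d hd.symm)
    · exact hold c d hcd
  card_le C hC := by
    classical
    have hcount := h.card_le C hC
    by_cases hvC : v ∈ C
    · have h1 : (Insert.insert v K \ K₀) \ (C : Set V) = (K \ K₀) \ C := by
        ext w
        simp only [Set.mem_sdiff, Set.mem_insert_iff, Finset.mem_coe]
        constructor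
        · rintro ⟨⟨rfl | hw, h1⟩, h2⟩
          · exact absurd hvC h2
          · exact ⟨⟨hw, h1⟩, h2⟩
        · rintro ⟨⟨hw, h1⟩, h2⟩
          exact ⟨⟨.inr hw, h1⟩, h2⟩
      have h2 : (C.image (relabel lab (lab a) (lab b))).card ≤ (C.image lab).card := by
        have : C.image (relabel lab (lab a) (lab b)) =
            (C.image lab).image fun t => if t = lab b then lab a else t := by
          rw [Finset.image_image]
          rfl
        rw [this]
        exact Finset.card_image_le
      rw [h1]
      omega
    · have haC : a ∈ C := mem_clique_of_adj hC ha hvC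
      have hbC : b ∈ C := mem_clique_of_adj hC hb hvC
      have h1 : ((Insert.insert v K \ K₀) \ (C : Set V)).ncard ≤ ((K \ K₀) \ C).ncard + 1 := by
        refine (Set.ncard_le_ncard (t := Insert.insert v ((K \ K₀) \ C)) ?_ (Set.toFinite _)).trans
          (Set.ncard_insert_le _ _)
        rintro w ⟨⟨rfl | hw, h1⟩, h2⟩
        · exact .inl rfl
        · exact .inr ⟨⟨hw, h1⟩, h2⟩
      have h2 : (C.image (relabel lab (lab a) (lab b))).card + 1 ≤ (C.image lab).card := by
        have hb' : lab b ∈ C.image lab := Finset.mem_image_of_mem lab hbC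
        have hsub : C.image (relabel lab (lab a) (lab b)) ⊆ (C.image lab).erase (lab b) := by
          intro t ht
          obtain ⟨c, hc, rfl⟩ := Finset.mem_image.1 ht
          unfold relabel
          rw [Finset.mem_erase]
          split_ifs with hcb
          · exact ⟨hab, Finset.mem_image_of_mem lab haC⟩
          · exact ⟨hcb, Finset.mem_image_of_mem lab hc⟩
        have := Finset.card_le_card hsub
        rw [Finset.card_erase_of_mem hb'] at this
        have := Finset.card_pos.2 ⟨_, hb'⟩
        omega
      omega

end Round

/-- The vertices that are marked in array `4`. -/
def kept (x : Instance) (A : ℕ → ℕ → ℕ) : Set (Fin x.n) := {v | A 4 v ≠ 0}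

/-- The labels in array `7`. -/
def labels (x : Instance) (A : ℕ → ℕ → ℕ) : Fin x.n → ℕ := fun v => A 7 v

/-- Each vertex gets a label of its own. -/
def initLabels : Program := forLoop 2 .numVert (.store 7 (.reg 2) (.reg 2))

/-- Replace the label of the vertex in register `3` by that of the vertex in register `2`, and mark
the vertex in register `1`. -/
def mergeLabels : Program :=
  .seq (.store 11 (.const 0) (.cell 7 (.reg 2)))
    (.seq (.store 11 (.const 1) (.cell 7 (.reg 3)))
      (.seq
        (forLoop 4 .numVert (.ite (.dist (.cell 7 (.reg 4)) (.cell 11 (.const 1))) .skip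
          (.store 7 (.reg 4) (.cell 11 (.const 0)))))
        (.store 4 (.reg 1) (.const 1))))

/-- Mark the vertex in register `1` if two of its neighbours have different labels, and give its
neighbours the same label. -/
def linkNeighbours : Program :=
  forLoop 2 .numVert (forLoop 3 .numVert
    (.ite (.adj (.reg 1) (.reg 2)) (.ite (.adj (.reg 1) (.reg 3))
      (.ite (.dist (.cell 7 (.reg 2)) (.cell 7 (.reg 3))) mergeLabels .skip) .skip) .skip))

/-- Construct a layer. -/
def computeLayer : Program :=
  .seq initLabels (forLoop 1 .numVert (.ite (.cell 4 (.reg 1)) .skip linkNeighbours))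

/-- Construct the layers, whose number is in `arr 10 0`. -/
def computeLayers : Program := forLoop 0 (.cell 10 (.const 0)) computeLayer

section

variable {x : Instance} {m : Memory}

theorem runs_initLabels (h : Ready x m.arr) :
    Runs initLabels m (x.n * 3 + 2) fun A => ∀ v : Fin x.n, A 7 v = v := by
  refine (Runs.forLoop (T := 1) (fun i A => ∀ v : Fin x.n, (v : ℕ) < i → A 7 v = v) (by decide)
    (fun m' h' => (h.congr (h' 0 (by decide)) (h' 2 (by decide))).eval_numVert) ?_ ?_).mono
    le_rfl fun A hA v => hA v v.2
  · intro v hv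
    omega
  · intro i hi m' hri hreg hA' hJ
    refine Runs.store fun v hv => ?_
    simp only [Expr.eval, hri, Function.update_self, Function.update_apply]
    split_ifs with hvi
    · exact hvi.symm
    · exact hJ v (by omega)

theorem runs_mergeLabels (h : Ready x m.arr) {v a b : Fin x.n} (hv : m.reg 1 = v)
    (ha : m.reg 2 = a) (hb : m.reg 3 = b) :
    Runs mergeLabels m (x.n * 4 + 5) fun A =>
      kept x A = insert v (kept x m.arr) ∧
      labels x A = relabel (labels x m.arr) (labels x m.arr a) (labels x m.arr b) := by
  have main : Runs mergeLabels m (1 + (1 + ((x.n * 4 + 2) + 1))) fun A =>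
      (∀ w : Fin x.n, A 4 w = if w = v then 1 else m.arr 4 w) ∧
      labels x A = relabel (labels x m.arr) (labels x m.arr a) (labels x m.arr b) := by
    refine Runs.seq (R := fun A => A 11 0 = labels x m.arr a)
      (Runs.store (by simp [Expr.eval, ha, labels])) fun m₁ h₁ hA₁ hr₁ => ?_
    refine Runs.seq (R := fun A => A 11 0 = labels x m.arr a ∧ A 11 1 = labels x m.arr b)
      (Runs.store ?_) fun m₂ h₂ hA₂ hr₂ => ?_
    · have : m₁.arr 7 = m.arr 7 := hA₁ 7 (by decide)
      simp [Expr.eval, hr₁ 3 (by decide), hb, labels, h₁, this]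
    have hready₂ : Ready x m₂.arr := (h.congr (hA₁ 0 (by decide)) (hA₁ 2 (by decide))).congr
      (hA₂ 0 (by decide)) (hA₂ 2 (by decide))
    have h7 : m₂.arr 7 = m.arr 7 := by rw [hA₂ 7 (by decide), hA₁ 7 (by decide)]
    refine Runs.seq (R := fun A => labels x A =
      relabel (labels x m.arr) (labels x m.arr a) (labels x m.arr b)) ?_ fun m₃ h₃ hA₃ hr₃ => ?_
    · refine (Runs.forLoop (T := 2) (fun i A => ∀ w : Fin x.n, A 7 w =
        if (w : ℕ) < i then relabel (labels x m.arr) (labels x m.arr a) (labels x m.arr b) w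
        else labels x m.arr w) (by decide)
        (fun m' h' => (hready₂.congr (h' 0 (by decide)) (h' 2 (by decide))).eval_numVert)
        (fun w => by simp [h7, labels]) ?_).mono le_rfl
        fun A hA => funext fun w => (hA w).trans (if_pos w.2)
      intro i hi m' hri hreg hA' hJ
      have h11 : m'.arr 11 = m₂.arr 11 := hA' 11 (by decide)
      have hi7 : m'.arr 7 i = labels x m.arr ⟨i, hi⟩ := by
        have := hJ ⟨i, hi⟩
        simpa using this
      refine Runs.ite (fun he => Runs.skip ?_) fun he => Runs.store ?_
      · rw [Ne, Expr.eval_dist_eq_zero] at he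
        simp only [Expr.eval, hri, h11, h₂.2, hi7] at he
        intro w
        rw [hJ w]
        by_cases hw : (w : ℕ) < i
        · rw [if_pos hw, if_pos (by omega)]
        · rw [if_neg hw]
          split_ifs with hw'
          · have : w = ⟨i, hi⟩ := Fin.ext (by simp only; omega)
            rw [this, relabel, if_neg he]
          · rfl
      · rw [Expr.eval_dist_eq_zero] at he
        simp only [Expr.eval, hri, h11, h₂.2, hi7] at he
        intro w
        simp only [Expr.eval, hri, Function.update_self, Function.update_apply, h11, h₂.1]
        by_cases hw : (w : ℕ) = i
        · have : w = ⟨i, hi⟩ := Fin.ext hw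
          rw [if_pos hw, if_pos (by omega), this, relabel, if_pos he]
        · rw [if_neg hw, hJ w]
          by_cases hw' : (w : ℕ) < i
          · rw [if_pos hw', if_pos (by omega)]
          · rw [if_neg hw', if_neg (by omega)]
    · have hr : m₃.reg 1 = v := by
        rw [hr₃ 1 (by decide), hr₂ 1 (by decide), hr₁ 1 (by decide), hv]
      have h4 : m₃.arr 4 = m.arr 4 := by
        rw [hA₃ 4 (by decide), hA₂ 4 (by decide), hA₁ 4 (by decide)]
      refine Runs.store ⟨fun w => ?_, ?_⟩
      · simp only [Expr.eval, hr, Function.update_self, Function.update_apply, h4, Fin.ext_iff]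
      · rw [← h₃]
        ext w
        simp [labels, Expr.eval]
  refine main.mono (by omega) fun A hA => ⟨?_, hA.2⟩
  ext w
  have := hA.1 w
  simp only [kept, Set.mem_ofPred_eq, Set.mem_insert_iff, this]
  split_ifs with hw <;> simp [hw]

/-- The state during the construction of a layer when the vertices below `v` have been
considered. -/
structure RoundState (x : Instance) (K₀ : Set (Fin x.n)) (v : ℕ) (A : ℕ → ℕ → ℕ) : Prop where
  isRound : IsRound x.graph K₀ (kept x A) (labels x A)
  mem_of_le : ∀ w : Fin x.n, v ≤ w → w ∈ kept x A → w ∈ K₀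
  labels_eq : ∀ w : Fin x.n, (w : ℕ) < v → w ∉ kept x A →
    ∀ a b, x.graph.Adj w a → x.graph.Adj w b → labels x A a = labels x A b

/-- The state while `v` is considered: in addition, the pairs of neighbours of `v` that precede
`(i, j)` in lexicographic order have equal labels. -/
structure PairState (x : Instance) (K₀ : Set (Fin x.n)) (v : Fin x.n) (i j : ℕ)
    (A : ℕ → ℕ → ℕ) : Prop where
  isRound : IsRound x.graph K₀ (kept x A) (labels x A)
  mem_of_le : ∀ w : Fin x.n, (v : ℕ) + 1 ≤ w → w ∈ kept x A → w ∈ K₀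
  labels_eq : ∀ w : Fin x.n, (w : ℕ) < v → w ∉ kept x A →
    ∀ a b, x.graph.Adj w a → x.graph.Adj w b → labels x A a = labels x A b
  pairs_eq : ∀ a b : Fin x.n, ((a : ℕ) < i ∨ (a : ℕ) = i ∧ (b : ℕ) < j) →
    x.graph.Adj v a → x.graph.Adj v b → labels x A a = labels x A b

theorem PairState.succ {K₀ : Set (Fin x.n)} {v a b : Fin x.n} {A : ℕ → ℕ → ℕ}
    (h : PairState x K₀ v a b A)
    (hab : x.graph.Adj v a → x.graph.Adj v b → labels x A a = labels x A b) :
    PairState x K₀ v a (b + 1) A where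
  isRound := h.isRound
  mem_of_le := h.mem_of_le
  labels_eq := h.labels_eq
  pairs_eq c d hcd hc hd := by
    by_cases heq : c = a ∧ d = b
    · obtain ⟨rfl, rfl⟩ := heq
      exact hab hc hd
    · refine h.pairs_eq c d ?_ hc hd
      rcases hcd with hcd | ⟨hca, hdb⟩
      · exact .inl hcd
      · have : (d : ℕ) ≠ b := fun hdb' => heq ⟨Fin.ext hca, Fin.ext hdb'⟩
        exact .inr ⟨hca, by omega⟩

theorem relabel_congr {V : Type*} {lab : V → ℕ} {p q : ℕ} {a b : V} (h : lab a = lab b) :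
    relabel lab p q a = relabel lab p q b := by
  simp only [relabel, h]

theorem PairState.merge {K₀ : Set (Fin x.n)} {v a b : Fin x.n} {A A' : ℕ → ℕ → ℕ}
    (h : PairState x K₀ v a b A) (hv : v ∉ K₀) (ha : x.graph.Adj v a) (hb : x.graph.Adj v b)
    (hab : labels x A a ≠ labels x A b) (hK : kept x A' = insert v (kept x A))
    (hlab : labels x A' = relabel (labels x A) (labels x A a) (labels x A b)) :
    PairState x K₀ v a (b + 1) A' := by
  refine PairState.succ ⟨?_, ?_, ?_, ?_⟩ ?_
  · rw [hK, hlab]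
    exact h.isRound.insert hv ha hb hab
  · intro w hw hwK
    rw [hK] at hwK
    rcases hwK with rfl | hwK
    · omega
    · exact h.mem_of_le w hw hwK
  · intro w hw hwK c d hc hd
    rw [hK, Set.mem_insert_iff, not_or] at hwK
    rw [hlab]
    exact relabel_congr (h.labels_eq w hw hwK.2 c d hc hd)
  · intro c d hcd hc hd
    rw [hlab]
    exact relabel_congr (h.pairs_eq c d hcd hc hd)
  · intro _ _
    rw [hlab]
    simp [relabel, hab]

theorem runs_linkNeighbours (h : Ready x m.arr) {K₀ : Set (Fin x.n)} {v : Fin x.n}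
    (hv : v ∉ K₀) (hr : m.reg 1 = v) (hs : RoundState x K₀ v m.arr) :
    Runs linkNeighbours m (x.n * (x.n * (x.n * 4 + 10) + 4) + 2) (RoundState x K₀ (v + 1)) := by
  have h0 : PairState x K₀ v 0 0 m.arr :=
    ⟨hs.isRound, fun w hw => hs.mem_of_le w (by omega), hs.labels_eq, fun a b hab => by omega⟩
  refine (Runs.forLoop (T := x.n * (x.n * 4 + 10) + 2) (fun i A => PairState x K₀ v i 0 A)
    (by decide)
    (fun m' h' => (h.congr (h' 0 (by decide)) (h' 2 (by decide))).eval_numVert) h0 ?_).mono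
    le_rfl fun A hA => ?_
  · intro i hi m' hri hreg hA' hJ
    have hr' := h.congr (hA' 0 (by decide)) (hA' 2 (by decide))
    refine (Runs.forLoop (T := x.n * 4 + 8) (fun j A => PairState x K₀ v i j A) (by decide)
      (fun m'' h'' => (hr'.congr (h'' 0 (by decide)) (h'' 2 (by decide))).eval_numVert) hJ
      ?_).mono (le_of_eq (by ring)) fun A hA => ?_
    · intro j hj m'' hrj hreg'' hA'' hJ'
      have hr'' := hr'.congr (hA'' 0 (by decide)) (hA'' 2 (by decide))
      have h1 : m''.reg 1 = v := by rw [hreg'' 1 (by decide), hreg 1 (by decide), hr]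
      have h2 : m''.reg 2 = i := by rw [hreg'' 2 (by decide), hri]
      set a : Fin x.n := ⟨i, hi⟩ with ha
      set b : Fin x.n := ⟨j, hj⟩ with hb
      have hJab : PairState x K₀ v a b m''.arr := hJ'
      have adj2 := hr''.eval_adj_ne_zero (e₁ := .reg 1) (e₂ := .reg 2) (v := v) (w := a)
        h1 h2
      have adj3 := hr''.eval_adj_ne_zero (e₁ := .reg 1) (e₂ := .reg 3) (v := v) (w := b)
        h1 hrj
      refine Runs.mono (T₁ := x.n * 4 + 5 + 1 + 1 + 1) ?_ (by omega) fun A hA => hA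
      refine Runs.ite (fun he₁ => Runs.ite (fun he₂ => Runs.ite (fun he₃ => ?_) fun he₃ => ?_)
        fun he₂ => ?_) fun he₁ => ?_
      · rw [Ne, Expr.eval_dist_eq_zero] at he₃
        simp only [Expr.eval, h2, hrj] at he₃
        exact (runs_mergeLabels hr'' h1 h2 hrj).mono le_rfl fun A hA =>
          hJab.merge hv (adj2.1 he₁) (adj3.1 he₂) he₃ hA.1 hA.2
      · rw [Expr.eval_dist_eq_zero] at he₃
        simp only [Expr.eval, h2, hrj] at he₃
        exact (Runs.skip (hJab.succ fun _ _ => he₃)).mono (by omega) fun _ h => h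
      · exact (Runs.skip (hJab.succ fun _ h => absurd he₂ (adj3.2 h))).mono (by omega)
          fun _ h => h
      · exact (Runs.skip (hJab.succ fun h _ => absurd he₁ (adj2.2 h))).mono (by omega)
          fun _ h => h
    · refine ⟨hA.isRound, hA.mem_of_le, hA.labels_eq, fun a b hab => hA.pairs_eq a b ?_⟩
      have := b.2
      omega
  · refine ⟨hA.isRound, hA.mem_of_le, fun w hw hwK a b ha hb => ?_⟩
    by_cases hwv : w = v
    · subst hwv
      exact hA.pairs_eq a b (.inl a.2) ha hb
    · have : (w : ℕ) ≠ v := fun h => hwv (Fin.ext h)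
      exact hA.labels_eq w (by omega) hwK a b ha hb

/-- The running time of `computeLayer`. -/
def layerTime (n : ℕ) : ℕ := n * 3 + 2 + (n * (n * (n * (n * 4 + 10) + 4) + 5) + 2)

theorem runs_computeLayer (h : Ready x m.arr) :
    Runs computeLayer m (layerTime x.n) (RoundState x (kept x m.arr) x.n) := by
  refine Runs.seq (runs_initLabels h) fun m₁ h₁ hA₁ hr₁ => ?_
  have hready := h.congr (hA₁ 0 (by decide)) (hA₁ 2 (by decide))
  have h4 : kept x m₁.arr = kept x m.arr := by
    simp only [kept, hA₁ 4 (by decide)]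
  refine (Runs.forLoop (T := x.n * (x.n * (x.n * 4 + 10) + 4) + 3)
    (fun v A => RoundState x (kept x m.arr) v A) (by decide)
    (fun m' h' => (hready.congr (h' 0 (by decide)) (h' 2 (by decide))).eval_numVert) ?_ ?_).mono
    le_rfl fun A hA => hA
  · refine ⟨?_, ?_, fun w hw => by omega⟩
    · rw [h4]
      exact IsRound.init _ fun a b hab => Fin.ext (by simpa [labels, h₁] using hab)
    · rw [h4]
      exact fun w _ hw => hw
  · intro i hi m' hri hreg hA' hJ
    have hr' := hready.congr (hA' 0 (by decide)) (hA' 2 (by decide))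
    set v : Fin x.n := ⟨i, hi⟩ with hv
    refine Runs.ite (fun he => ?_) fun he => ?_
    · refine (Runs.skip ?_).mono (by omega) fun _ h => h
      refine ⟨hJ.isRound, fun w hw => hJ.mem_of_le w (by omega), fun w hw hwK => ?_⟩
      by_cases hwv : w = v
      · subst hwv
        refine absurd ?_ hwK
        simpa [kept, Expr.eval, hri] using he
      · have : (w : ℕ) ≠ i := fun h => hwv (Fin.ext h)
        exact hJ.labels_eq w (by omega) hwK
    · refine runs_linkNeighbours hr' (v := v) (fun hv₀ => ?_) hri hJ
      have := hJ.isRound.subset hv₀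
      simp only [kept, Set.mem_ofPred_eq] at this
      exact this (by simpa [Expr.eval, hri] using he)

/-- The state after the construction of `f` layers. -/
def LayersState (x : Instance) (f : ℕ) (A : ℕ → ℕ → ℕ) : Prop :=
  ∃ L : ℕ → Set (Fin x.n), Layering x.graph f (kept x A) L ∧ (∀ o, x.terminal o ∈ kept x A) ∧
    (∀ v ∈ kept x A, (∃ o, x.terminal o = v) ∨ ∃ j < f, v ∈ L j) ∧
    ∀ C : Finset (Fin x.n), x.graph.IsIndepSet (C : Set (Fin x.n))ᶜ →
      ∀ j < f, (L j \ C).ncard ≤ C.card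

theorem layersState_zero {A : ℕ → ℕ → ℕ} (h : ∀ v : Fin x.n, A 4 v = x.occ v) :
    LayersState x 0 A := by
  have hmem : ∀ v, v ∈ kept x A ↔ ∃ o, x.terminal o = v := by
    intro v
    simp only [kept, Set.mem_ofPred_eq, h, Instance.occ, Finset.card_ne_zero]
    simp [Finset.Nonempty]
  exact ⟨fun _ => ∅, ⟨by simp, by simp, by simp⟩, fun o => (hmem _).2 ⟨o, rfl⟩,
    fun v hv => .inl ((hmem v).1 hv), by simp⟩

theorem LayersState.succ {f : ℕ} {A A' : ℕ → ℕ → ℕ} (h : LayersState x f A)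
    (hA : RoundState x (kept x A) x.n A') : LayersState x (f + 1) A' := by
  classical
  obtain ⟨L, hL, hT, hK, hcount⟩ := h
  have hsub := hA.isRound.subset
  have hself : Function.update L f (kept x A' \ kept x A) f = kept x A' \ kept x A :=
    Function.update_self ..
  have hne : ∀ j, j < f → Function.update L f (kept x A' \ kept x A) j = L j := fun j hj =>
    Function.update_of_ne hj.ne ..
  refine ⟨Function.update L f (kept x A' \ kept x A), ⟨?_, ?_, ?_⟩, fun o => hsub (hT o), ?_, ?_⟩
  · intro j hj
    rcases Nat.lt_succ_iff_lt_or_eq.1 hj with hj | rfl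
    · rw [hne j hj]
      exact (hL.subset j hj).trans hsub
    · rw [hself]
      exact Set.sdiff_subset
  · have key : ∀ j < f, Disjoint (L j) (kept x A' \ kept x A) := fun j hj =>
      Set.disjoint_sdiff_right.mono_left (hL.subset j hj)
    intro i hi j hj hij
    rcases Nat.lt_succ_iff_lt_or_eq.1 hi with hi | rfl
    · rcases Nat.lt_succ_iff_lt_or_eq.1 hj with hj | rfl
      · rw [hne i hi, hne j hj]
        exact hL.disjoint i hi j hj hij
      · rw [hne i hi, hself]
        exact key i hi
    · rcases Nat.lt_succ_iff_lt_or_eq.1 hj with hj | rfl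
      · rw [hne j hj, hself]
        exact (key j hj).symm
      · exact absurd rfl hij
  · intro v hv j hj a b ha hb
    rcases Nat.lt_succ_iff_lt_or_eq.1 hj with hj | rfl
    · rw [hne j hj]
      exact hL.linked v (fun h => hv (hsub h)) j hj a b ha hb
    · rw [hself]
      exact hA.isRound.linked a b (hA.labels_eq v v.2 hv a b ha hb)
  · intro v hv
    by_cases hv' : v ∈ kept x A
    · rcases hK v hv' with h | ⟨j, hj, hvj⟩
      · exact .inl h
      · exact .inr ⟨j, by omega, by rwa [hne j hj]⟩
    · exact .inr ⟨f, by omega, by rw [hself]; exact ⟨hv, hv'⟩⟩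
  · intro C hC j hj
    rcases Nat.lt_succ_iff_lt_or_eq.1 hj with hj | rfl
    · rw [hne j hj]
      exact hcount C hC j hj
    · rw [hself]
      have := hA.isRound.card_le C hC
      omega

theorem runs_computeLayers (h : Ready x m.arr) {f : ℕ} (h10 : m.arr 10 0 = f)
    (hs : LayersState x 0 m.arr) :
    Runs computeLayers m (f * (layerTime x.n + 2) + 2) (LayersState x f) := by
  refine Runs.forLoop (LayersState x) (by decide)
    (fun m' h' => by simp only [Expr.eval, h' 10 (by decide), h10]) hs ?_
  intro i hi m' hri hreg hA' hJ
  exact (runs_computeLayer (h.congr (hA' 0 (by decide)) (hA' 2 (by decide)))).mono le_rfl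
    fun A hA => hJ.succ hA

/-- The number of kept vertices: the terminals, the clique, and at most `C.card` vertices of
each layer outside the clique. -/
theorem LayersState.exists_finset {f : ℕ} {A : ℕ → ℕ → ℕ} (h : LayersState x f A)
    {C : Finset (Fin x.n)} (hC : x.graph.IsIndepSet (C : Set (Fin x.n))ᶜ) :
    ∃ S : Finset (Fin x.n), (∀ v ∈ kept x A, v ∈ S) ∧ S.card ≤ 2 * x.k + C.card + f * C.card := by
  classical
  obtain ⟨L, -, -, hK, hcount⟩ := h
  refine ⟨Finset.univ.image x.terminal ∪ C ∪
    (Finset.range f).biUnion fun j => (L j \ C).toFinset, ?_, ?_⟩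
  · intro v hv
    simp only [Finset.mem_union, Finset.mem_image, Finset.mem_univ, true_and, Finset.mem_biUnion,
      Finset.mem_range, Set.mem_toFinset, Set.mem_sdiff, Finset.mem_coe]
    rcases hK v hv with h | ⟨j, hj, hvj⟩
    · exact .inl (.inl h)
    · by_cases hvC : v ∈ C
      · exact .inl (.inr hvC)
      · exact .inr ⟨j, hj, hvj, hvC⟩
  · have h1 : (Finset.univ.image x.terminal).card ≤ 2 * x.k := by
      refine Finset.card_image_le.trans ?_
      simp [Instance.k, mul_comm]
    have h2 : ((Finset.range f).biUnion fun j => (L j \ C).toFinset).card ≤ f * C.card := by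
      refine (Finset.card_biUnion_le_card_mul _ _ C.card fun j hj => ?_).trans (by simp)
      rw [← Set.ncard_eq_toFinset_card']
      exact hcount C hC j (Finset.mem_range.1 hj)
    have h3 := Finset.card_union_le (Finset.univ.image x.terminal ∪ C)
      ((Finset.range f).biUnion fun j => (L j \ C).toFinset)
    have h4 := Finset.card_union_le (Finset.univ.image x.terminal) C
    omega

end

end EDP

namespace EDP

open Program

/-! ### Numbering the kept vertices and writing the output -/

/-- Enumerate the kept vertices in array `12`, their positions in array `13`, and their number in
`arr 14 0`. -/
def numberVertices : Program :=
  forLoop 1 .numVert (.ite (.cell 4 (.reg 1))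
    (.seq (.store 12 (.cell 14 (.const 0)) (.reg 1))
      (.seq (.store 13 (.reg 1) (.cell 14 (.const 0)))
        (.store 14 (.const 0) (.add (.cell 14 (.const 0)) (.const 1))))) .skip)

/-- Append the value of `e` to the output. The length of the output is kept in `arr 15 0`. -/
def push (e : Expr) : Program :=
  .seq (.store 1 (.cell 15 (.const 0)) e)
    (.store 15 (.const 0) (.add (.cell 15 (.const 0)) (.const 1)))

/-- Append a fixed list to the output. -/
def pushAll : List ℕ → Program
  | [] => .skip
  | c :: l => .seq (push (.const c)) (pushAll l)

/-- Write the adjacency matrix of the graph induced on the kept vertices. -/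
def writeMatrix : Program :=
  forLoop 1 (.cell 14 (.const 0)) (forLoop 2 (.cell 14 (.const 0))
    (push (.adj (.cell 12 (.reg 1)) (.cell 12 (.reg 2)))))

/-- Write the terminal pairs with their new numbers. -/
def writePairs : Program :=
  forLoop 1 .param (.seq (push (.cell 13 (.fst (.reg 1)))) (push (.cell 13 (.snd (.reg 1)))))

/-- Write the instance induced on the kept vertices. -/
def writeInduced : Program :=
  .seq (push (.cell 14 (.const 0))) (.seq (push .param) (.seq writeMatrix writePairs))

/-- The first `v` vertices have been numbered; `K` is the set of kept vertices. -/
structure IsNumbering (x : Instance) (K : Set (Fin x.n)) (v : ℕ) (A : ℕ → ℕ → ℕ) : Prop where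
  exists_eq : ∀ i < A 14 0, ∃ w : Fin x.n, A 12 i = w ∧ (w : ℕ) < v ∧ w ∈ K ∧ A 13 w = i
  lt_and_eq : ∀ w : Fin x.n, (w : ℕ) < v → w ∈ K → A 13 w < A 14 0 ∧ A 12 (A 13 w) = w

/-- The output written so far is the list `l`. -/
def HasWritten (A : ℕ → ℕ → ℕ) (l : List ℕ) : Prop :=
  A 15 0 = l.length ∧ ∀ (i : ℕ) (h : i < l.length), A 1 i = l[i]

section

variable {x : Instance} {m : Memory}

theorem runs_numberVertices (h : Ready x m.arr) (h14 : m.arr 14 0 = 0) :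
    Runs numberVertices m (x.n * 6 + 2) (IsNumbering x (kept x m.arr) x.n) := by
  refine Runs.forLoop (T := 4) (fun v A => IsNumbering x (kept x m.arr) v A) (by decide)
    (fun m' h' => (h.congr (h' 0 (by decide)) (h' 2 (by decide))).eval_numVert) ?_ ?_
  · exact ⟨fun i hi => by omega, fun w hw => by omega⟩
  · intro i hi m' hri hreg hA' hJ
    set v : Fin x.n := ⟨i, hi⟩ with hv
    have h4 : m'.arr 4 = m.arr 4 := hA' 4 (by decide)
    refine Runs.ite (fun he => ?_) fun he => ?_
    · have hvK : v ∈ kept x m.arr := by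
        simpa [kept, Expr.eval, hri, h4] using he
      have main : Runs (.seq (.store 12 (.cell 14 (.const 0)) (.reg 1))
          (.seq (.store 13 (.reg 1) (.cell 14 (.const 0)))
            (.store 14 (.const 0) (.add (.cell 14 (.const 0)) (.const 1))))) m' (1 + (1 + 1))
          fun A => A 12 = Function.update (m'.arr 12) (m'.arr 14 0) i ∧
            A 13 = Function.update (m'.arr 13) i (m'.arr 14 0) ∧ A 14 0 = m'.arr 14 0 + 1 := by
        refine Runs.seq (R := fun A => A 12 = Function.update (m'.arr 12) (m'.arr 14 0) i)
          (Runs.store (by simp [Expr.eval, hri])) fun m₁ h₁ hA₁ hr₁ => ?_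
        have h14₁ : m₁.arr 14 = m'.arr 14 := hA₁ 14 (by decide)
        have h13₁ : m₁.arr 13 = m'.arr 13 := hA₁ 13 (by decide)
        refine Runs.seq (R := fun A => A 12 = Function.update (m'.arr 12) (m'.arr 14 0) i ∧
            A 13 = Function.update (m'.arr 13) i (m'.arr 14 0))
          (Runs.store ?_) fun m₂ h₂ hA₂ hr₂ => Runs.store ?_
        · simp [Expr.eval, h₁, hr₁ 1 (by decide), hri, h14₁, h13₁]
        · have h14₂ : m₂.arr 14 = m'.arr 14 := by rw [hA₂ 14 (by decide), h14₁]
          simp [Expr.eval, h₂, h14₂]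
      refine main.mono le_rfl fun A hA => ⟨?_, ?_⟩
      · intro j hj
        rw [hA.2.2] at hj
        rw [hA.1, hA.2.1]
        by_cases hjc : j = m'.arr 14 0
        · refine ⟨v, ?_, Nat.lt_succ_self i, hvK, ?_⟩
          · rw [hjc, Function.update_self]
          · rw [hv, Function.update_self, hjc]
        · obtain ⟨w, hw1, hw2, hw3, hw4⟩ := hJ.exists_eq j (by omega)
          refine ⟨w, ?_, by omega, hw3, ?_⟩
          · rw [Function.update_of_ne hjc, hw1]
          · rw [Function.update_of_ne (by omega), hw4]
      · intro w hw hwK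
        rw [hA.1, hA.2.1, hA.2.2]
        by_cases hwi : (w : ℕ) = i
        · rw [hwi, Function.update_self, Function.update_self]
          exact ⟨Nat.lt_succ_self _, rfl⟩
        · obtain ⟨h1, h2⟩ := hJ.lt_and_eq w (by omega) hwK
          rw [Function.update_of_ne hwi, Function.update_of_ne (by omega)]
          exact ⟨by omega, h2⟩
    · have hvK : v ∉ kept x m.arr := by
        simpa [kept, Expr.eval, hri, h4] using he
      refine (Runs.skip ⟨fun j hj => ?_, fun w hw hwK => ?_⟩).mono (by omega) fun _ h => h
      · obtain ⟨w, hw1, hw2, hw3⟩ := hJ.exists_eq j hj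
        exact ⟨w, hw1, by omega, hw3⟩
      · have : (w : ℕ) ≠ i := fun h => hvK ((Fin.ext h : w = v) ▸ hwK)
        exact hJ.lt_and_eq w (by omega) hwK

theorem runs_push {l : List ℕ} {e : Expr} (h : HasWritten m.arr l) :
    Runs (push e) m 2 fun A => HasWritten A (l ++ [e.eval m]) := by
  refine Runs.seq (T₁ := 1) (T₂ := 1)
    (R := fun A => A 1 = Function.update (m.arr 1) l.length (e.eval m))
    (Runs.store (by simp [Expr.eval, h.1])) fun m₁ h₁ hA₁ hr₁ => Runs.store ?_
  have h15 : m₁.arr 15 0 = l.length := by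
    rw [hA₁ 15 (by simp [Program.arrs]), h.1]
  refine ⟨by simp [Expr.eval, h15], fun i hi => ?_⟩
  rw [List.length_append, List.length_singleton] at hi
  rw [Function.update_of_ne (by decide), h₁]
  by_cases hil : i < l.length
  · rw [Function.update_of_ne hil.ne, List.getElem_append_left hil]
    exact h.2 i hil
  · have : i = l.length := by omega
    subst this
    simp

theorem runs_pushAll (l' : List ℕ) {l : List ℕ} (h : HasWritten m.arr l) :
    Runs (pushAll l') m (2 * l'.length + 1) fun A => HasWritten A (l ++ l') := by
  induction l' generalizing m l with
  | nil => exact (Runs.skip (Q := fun A => HasWritten A l) h).mono (by simp) (by simp)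
  | cons c l' ih =>
    refine (Runs.seq (runs_push (e := .const c) h) fun m' h' _ _ => ih h').mono ?_ fun A hA => ?_
    · simp only [List.length_cons]
      omega
    · simpa [Expr.eval] using hA

theorem runs_writeMatrix {l : List ℕ} (h : HasWritten m.arr l) :
    Runs writeMatrix m (m.arr 14 0 * (m.arr 14 0 * 4 + 4) + 2) fun A => HasWritten A
      (l ++ (List.range (m.arr 14 0)).flatMap fun i => (List.range (m.arr 14 0)).map fun j =>
        m.arr 0 (m.arr 2 (m.arr 12 i) + m.arr 12 j)) := by
  refine Runs.forLoop (T := m.arr 14 0 * 4 + 2) (fun c A => HasWritten A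
    (l ++ (List.range c).flatMap fun i => (List.range (m.arr 14 0)).map fun j =>
        m.arr 0 (m.arr 2 (m.arr 12 i) + m.arr 12 j))) (by decide)
    (fun m' h' => by simp only [Expr.eval, h' 14 (by decide)]) (by simpa using h) ?_
  intro i hi m₁ hri _ hA₁ hJ
  refine (Runs.forLoop (T := 2) (fun c A => HasWritten A
    ((l ++ (List.range i).flatMap fun i => (List.range (m.arr 14 0)).map fun j =>
        m.arr 0 (m.arr 2 (m.arr 12 i) + m.arr 12 j)) ++
      (List.range c).map fun j => m.arr 0 (m.arr 2 (m.arr 12 i) + m.arr 12 j))) (by decide)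
    (fun m' h' => by
      simp only [Expr.eval, h' 14 (by decide), hA₁ 14 (by decide)])
    (by simpa using hJ) ?_).mono le_rfl fun A hA => ?_
  · intro j hj m₂ hrj hreg hA₂ hJ'
    refine (runs_push hJ').mono le_rfl fun A hA => ?_
    have h1 : m₂.reg 1 = i := by rw [hreg 1 (by decide), hri]
    have e0 : m₂.arr 0 = m.arr 0 := by rw [hA₂ 0 (by decide), hA₁ 0 (by decide)]
    have e2 : m₂.arr 2 = m.arr 2 := by rw [hA₂ 2 (by decide), hA₁ 2 (by decide)]
    have e12 : m₂.arr 12 = m.arr 12 := by rw [hA₂ 12 (by decide), hA₁ 12 (by decide)]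
    simp only [Expr.adj, Expr.eval, h1, hrj, e0, e2, e12] at hA
    rw [List.range_succ, List.map_append, ← List.append_assoc]
    exact hA
  · rw [List.range_succ, List.flatMap_append, ← List.append_assoc]
    simpa using hA

theorem runs_writePairs (hx : Ready x m.arr) {l : List ℕ} (h : HasWritten m.arr l) :
    Runs writePairs m (x.k * 6 + 2) fun A => HasWritten A
      (l ++ (List.finRange x.pairs.length).flatMap fun p =>
        [m.arr 13 (x.terminal (p, true)), m.arr 13 (x.terminal (p, false))]) := by
  have hfin : (List.finRange x.pairs.length).take x.k = List.finRange x.pairs.length :=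
    List.take_of_length_le (by simp [Instance.k])
  refine (Runs.forLoop (T := 4) (fun c A => HasWritten A
    (l ++ ((List.finRange x.pairs.length).take c).flatMap fun p =>
        [m.arr 13 (x.terminal (p, true)), m.arr 13 (x.terminal (p, false))])) (by decide)
    (fun m' h' => (hx.congr (h' 0 (by decide)) (h' 2 (by decide))).eval_param)
    (by simpa using h) ?_).mono le_rfl fun A hA => by rwa [hfin] at hA
  intro i hi m₁ hri _ hA₁ hJ
  set p : Fin x.pairs.length := ⟨i, hi⟩ with hp
  have hx₁ := hx.congr (hA₁ 0 (by decide)) (hA₁ 2 (by decide))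
  have e13 : m₁.arr 13 = m.arr 13 := hA₁ 13 (by decide)
  refine (Runs.seq (runs_push (e := .cell 13 (.fst (.reg 1))) hJ) fun m₂ h₂ hA₂ hr₂ =>
    (runs_push (e := .cell 13 (.snd (.reg 1))) h₂).mono
      (Q := fun A => HasWritten A (l ++ ((List.finRange x.pairs.length).take (i + 1)).flatMap
        fun p => [m.arr 13 (x.terminal (p, true)), m.arr 13 (x.terminal (p, false))]))
      le_rfl fun A hA => ?_).mono le_rfl fun _ h => h
  have hx₂ := hx₁.congr (hA₂ 0 (by decide)) (hA₂ 2 (by decide))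
  have f1 : (Expr.fst (.reg 1)).eval m₁ = x.terminal (p, true) := hx₁.eval_fst hri
  have f2 : (Expr.snd (.reg 1)).eval m₂ = x.terminal (p, false) :=
    hx₂.eval_snd (by simp only [Expr.eval]; rw [hr₂ 1 (by decide), hri])
  have e13' : m₂.arr 13 = m.arr 13 := by rw [hA₂ 13 (by decide), e13]
  have htake : (List.finRange x.pairs.length).take (i + 1) =
      (List.finRange x.pairs.length).take i ++ [p] := by
    rw [List.take_add_one, List.getElem?_eq_getElem (by rw [List.length_finRange]; exact hi)]
    simp [hp]
  rw [htake, List.flatMap_append]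
  simp only [Expr.eval] at hA
  rw [f1, f2, e13, e13'] at hA
  simpa using hA

/-- The numbering arrays describe the instance that `x` induces on the set of kept vertices; its
encoding is the list that `writeInduced` writes. -/
theorem exists_isInduced {K : Set (Fin x.n)} {A : ℕ → ℕ → ℕ} (hx : Ready x A)
    (hA : IsNumbering x K x.n A) (hT : ∀ o, x.terminal o ∈ K) :
    ∃ (y : Instance) (f : Fin y.n → Fin x.n), Instance.IsInduced x y K f ∧
      y.encode = [A 14 0, x.k] ++
        ((List.range (A 14 0)).flatMap fun i => (List.range (A 14 0)).map fun j =>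
          A 0 (A 2 (A 12 i) + A 12 j)) ++
        (List.finRange x.pairs.length).flatMap fun p =>
          [A 13 (x.terminal (p, true)), A 13 (x.terminal (p, false))] := by
  classical
  choose f hf hlt hfK hf13 using fun i : Fin (A 14 0) => hA.exists_eq i i.2
  let g : Fin x.pairs.length × Bool → Fin (A 14 0) := fun o =>
    ⟨A 13 (x.terminal o), (hA.lt_and_eq _ (x.terminal o).2 (hT o)).1⟩
  have hfg : ∀ o, f (g o) = x.terminal o := fun o => Fin.ext (by
    rw [← hf (g o)]
    exact (hA.lt_and_eq _ (x.terminal o).2 (hT o)).2)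
  have hpairs : x.pairs =
      (List.ofFn fun p => (g (p, true), g (p, false))).map (Prod.map f f) := by
    rw [List.map_ofFn]
    conv_lhs => rw [← List.ofFn_get x.pairs]
    congr 1
    funext p
    simp only [Function.comp, Prod.map, hfg]
    simp [Instance.terminal]
  refine ⟨⟨A 14 0, x.graph.comap f, List.ofFn fun p => (g (p, true), g (p, false)), ?_⟩, f,
    ⟨?_, ?_, fun i j => Iff.rfl, hpairs⟩, ?_⟩
  · intro p hp heq
    obtain ⟨q, rfl⟩ := List.mem_ofFn.1 hp
    refine x.terminal_ne q ?_
    rw [← hfg, ← hfg]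
    exact congrArg f heq
  · intro i j hij
    refine Fin.ext ?_
    rw [← hf13 i, ← hf13 j, hij]
  · intro v
    constructor
    · intro hv
      obtain ⟨h1, h2⟩ := hA.lt_and_eq v v.2 hv
      exact ⟨⟨_, h1⟩, Fin.ext (by rw [← hf ⟨_, h1⟩]; exact h2)⟩
    · rintro ⟨i, rfl⟩
      exact hfK i
  · have hadj : ∀ i j : Fin (A 14 0), A 0 (A 2 (A 12 i) + A 12 j) =
        if x.graph.Adj (f i) (f j) then 1 else 0 := by
      intro i j
      rw [hf i, hf j, hx.row _ (f i).2.le]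
      have h1 := hx.input.adj_ne_zero (f i) (f j)
      have h2 := hx.input.adj_le_one (f i) (f j)
      split_ifs with hadj
      · have := h1.2 hadj
        omega
      · by_contra h3
        exact hadj (h1.1 h3)
    have hrange : List.range (A 14 0) = (List.finRange (A 14 0)).map Fin.val :=
      (List.map_coe_finRange_eq_range).symm
    have hmat : ((List.range (A 14 0)).flatMap fun i => (List.range (A 14 0)).map fun j =>
          A 0 (A 2 (A 12 i) + A 12 j)) = (List.finRange (A 14 0)).flatMap fun i =>
          (List.finRange (A 14 0)).map fun j => if x.graph.Adj (f i) (f j) then 1 else 0 := by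
      rw [hrange, List.flatMap_map]
      refine List.flatMap_congr fun i _ => ?_
      rw [List.map_map]
      exact List.map_congr_left fun j _ => hadj i j
    rw [hmat]
    simp only [Instance.encode, Instance.k, List.ofFn_eq_map, List.flatMap_map]
    congr 2
    simp

end

end EDP

namespace EDP

open Program

/-! ### The kernelization -/

/-- The case of a small clique: compute the layers and write the instance induced on the
kept vertices. -/
def reduceInstance : Program :=
  .seq computeSqrt (.seq computeNumLayers (.seq computeLayers (.seq numberVertices writeInduced)))

/-- The case of a large clique: decide the instance and write a trivial one. -/
def decideInstance : Program :=
  .ite (.cell 6 (.const 0))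
    (.ite (.sub .param (.const 1)) (pushAll [2, 2, 0, 1, 1, 0, 0, 1, 0, 1])
      (pushAll [2, 1, 0, 0, 0, 0, 0, 1]))
    (pushAll [1, 0, 0])

/-- The kernelization algorithm. -/
def kernelize : Program :=
  .seq computeRows (.seq computeDegrees (.seq computeOccurrences (.seq countHigh
    (.seq checkDegrees
      (.ite (.sub (.cell 5 (.const 0)) (.times 4 .param)) decideInstance reduceInstance)))))

/-- The properties that a kernelization requires of the output `y` on input `x`. -/
structure IsKernel (x y : Instance) : Prop where
  isSplit : y.IsSplit
  connected : x.graph.Connected → y.graph.Connected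
  isYes_iff : x.IsYes ↔ y.IsYes
  k_le : y.k ≤ x.k
  n_le : y.n ≤ 2 + 6 * x.k + 40 * x.k * x.k * (Nat.sqrt x.k + 1)

section

variable {x : Instance} {m : Memory}

theorem runs_decideInstance (hx : x.IsSplit) (h : Ready x m.arr) (h15 : m.arr 15 0 = 0)
    (hhigh : 4 * x.k < x.numHigh (4 * x.k)) (h6 : m.arr 6 0 ≠ 0 ↔ ∃ v, x.deg v < x.occ v) :
    Runs decideInstance m 23 fun A => ∃ y, HasWritten A y.encode ∧ IsKernel x y := by
  have h0 : HasWritten m.arr [] := ⟨h15, by simp⟩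
  obtain ⟨C, hC, hI⟩ := Instance.exists_finset_of_isSplit hx
  have hCk := Instance.le_card_of_lt_numHigh hI hhigh
  refine Runs.mono (T₁ := 21 + 1 + 1) (Runs.ite (fun he => ?_) fun he => ?_) le_rfl fun _ h => h
  · obtain ⟨v, hv⟩ := h6.1 he
    have hno : ¬ x.IsYes := fun hyes => absurd (hyes.occ_le_deg v) (not_le.2 hv)
    have hocc : x.occ v ≠ 0 := by omega
    have hk : 1 ≤ x.k := by
      obtain ⟨o, -⟩ := Finset.card_ne_zero.1 hocc
      have : (o.1 : ℕ) < x.k := o.1.2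
      omega
    refine Runs.ite (fun he₁ => ?_) fun he₁ => ?_
    · simp only [Expr.eval, h.eval_param] at he₁
      refine (runs_pushAll _ h0).mono (by decide) fun A hA =>
        ⟨_, Instance.encode_noInstance₂ ▸ hA, ?_⟩
      exact ⟨Instance.isSplit_noInstance₂, fun _ => Instance.connected_noInstance₂,
        iff_of_false hno Instance.not_isYes_noInstance₂,
        (by change 2 ≤ x.k; omega), by change 2 ≤ _; omega⟩
    · simp only [Expr.eval, h.eval_param] at he₁
      refine (runs_pushAll _ h0).mono (by decide) fun A hA =>
        ⟨_, Instance.encode_noInstance₁ ▸ hA, ?_⟩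
      -- With a single pair, the terminal `v` has no neighbour at all.
      have hdeg : x.deg v = 0 := by
        have : x.occ v ≤ 1 := by
          refine Finset.card_le_one.2 ?_
          rintro ⟨i, b⟩ hi ⟨j, c⟩ hj
          have hij : i = j := Fin.ext (by
            have h1 : (i : ℕ) < x.k := i.2
            have h2 : (j : ℕ) < x.k := j.2
            omega)
          subst hij
          have hne := x.terminal_ne i
          have hi' : x.terminal (i, b) = v := by simpa using hi
          have hj' : x.terminal (i, c) = v := by simpa using hj
          cases b <;> cases c <;> simp_all
        omega
      exact ⟨Instance.isSplit_noInstance₁,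
        fun hconn => absurd hconn (Instance.not_connected_of_deg_eq_zero hdeg hocc),
        iff_of_false hno Instance.not_isYes_noInstance₁, hk, by change 2 ≤ _; omega⟩
  · have hyes : x.IsYes := Instance.isYes_of_occ_le_deg hC hI (by omega) fun v => by
      by_contra hv
      exact h6.2 ⟨v, not_le.1 hv⟩ he
    refine (runs_pushAll _ h0).mono (by decide) fun A hA =>
      ⟨_, Instance.encode_yesInstance ▸ hA, ?_⟩
    exact ⟨Instance.isSplit_yesInstance, fun _ => Instance.connected_yesInstance,
      iff_of_true hyes Instance.isYes_yesInstance, Nat.zero_le _, by change 1 ≤ _; omega⟩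

/-- The running time of `reduceInstance`. -/
def reduceTime (n k : ℕ) : ℕ :=
  ((k + 1) * 5 + 2) + (((k + 1) * 3 + 2) + ((10 * k * (k + 1) * (layerTime n + 2) + 2) +
    ((n * 6 + 2) + (2 + (2 + ((n * (n * 4 + 4) + 2) + (k * 6 + 2)))))))

theorem isKernel_of_layersState (hx : x.IsSplit) (hhigh : x.numHigh (4 * x.k) ≤ 4 * x.k)
    {A : ℕ → ℕ → ℕ} (hA : LayersState x (10 * x.k * (Nat.sqrt x.k + 1)) A) {y : Instance}
    {f : Fin y.n → Fin x.n} (hf : Instance.IsInduced x y (kept x A) f) : IsKernel x y := by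
  obtain ⟨C, hC, hI⟩ := Instance.exists_finset_of_isSplit hx
  have hCk := Instance.card_le_of_numHigh_le hC hhigh
  obtain ⟨S, hS, hScard⟩ := hA.exists_finset hI
  obtain ⟨L, hL, hT, -, -⟩ := hA
  refine ⟨hf.isSplit hx, fun hconn => ?_, hf.isYes_iff_isYes hL hC hI hCk le_rfl hT, hf.k_eq.le,
    ?_⟩
  · have hk : x.k ≠ 0 := by
      intro hk
      have : Nonempty (Fin x.n) := hconn.nonempty
      rw [hk, Nat.mul_zero, Nat.le_zero, Instance.numHigh, Finset.card_eq_zero] at hhigh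
      obtain ⟨v⟩ := this
      have : v ∈ Finset.univ.filter fun v => 0 ≤ x.deg v := by simp
      rw [hhigh] at this
      simp at this
    refine hf.connected hL hC hI ?_ ?_ hconn
    · have : 1 ≤ x.k := by omega
      nlinarith [Nat.zero_le (x.k * Nat.sqrt x.k)]
    · exact ⟨_, hT (⟨0, Nat.pos_of_ne_zero hk⟩, true)⟩
  · have h1 := hf.card_le S hS
    have h2 : 10 * x.k * (Nat.sqrt x.k + 1) * C.card ≤
        10 * x.k * (Nat.sqrt x.k + 1) * (4 * x.k) := Nat.mul_le_mul_left _ hCk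
    have h3 : 10 * x.k * (Nat.sqrt x.k + 1) * (4 * x.k) =
        40 * x.k * x.k * (Nat.sqrt x.k + 1) := by ring
    omega

theorem IsNumbering.le {K : Set (Fin x.n)} {A : ℕ → ℕ → ℕ} (h : IsNumbering x K x.n A) :
    A 14 0 ≤ x.n := by
  choose f hf using fun i : Fin (A 14 0) => h.exists_eq i i.2
  have hinj : Function.Injective f := by
    intro i j hij
    refine Fin.ext ?_
    rw [← (hf i).2.2.2, ← (hf j).2.2.2, hij]
  simpa using Fintype.card_le_of_injective f hinj

theorem runs_writeInduced {K : Set (Fin x.n)} (h : Ready x m.arr) (h15 : m.arr 15 0 = 0)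
    (hm : IsNumbering x K x.n m.arr) (hT : ∀ o, x.terminal o ∈ K) :
    Runs writeInduced m (2 + (2 + ((x.n * (x.n * 4 + 4) + 2) + (x.k * 6 + 2)))) fun A =>
      ∃ (y : Instance) (f : Fin y.n → Fin x.n), Instance.IsInduced x y K f ∧
        HasWritten A y.encode := by
  obtain ⟨y, f, hf, hy⟩ := exists_isInduced h hm hT
  have h0 : HasWritten m.arr [] := ⟨h15, by simp⟩
  refine Runs.seq (runs_push h0) fun m₁ h₁ hA₁ _ => ?_
  have r₁ := h.congr (hA₁ 0 (by decide)) (hA₁ 2 (by decide))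
  refine Runs.seq (runs_push h₁) fun m₂ h₂ hA₂ _ => ?_
  have r₂ := r₁.congr (hA₂ 0 (by decide)) (hA₂ 2 (by decide))
  have e : ∀ a ∉ [1, 15], m₂.arr a = m.arr a := by
    intro a ha
    rw [hA₂ a (by simpa [push, Program.arrs] using ha),
      hA₁ a (by simpa [push, Program.arrs] using ha)]
  refine Runs.seq ((runs_writeMatrix h₂).mono ?_ fun _ h => h) fun m₃ h₃ hA₃ _ => ?_
  · rw [e 14 (by decide)]
    have := hm.le
    gcongr
  have r₃ := r₂.congr (hA₃ 0 (by decide)) (hA₃ 2 (by decide))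
  refine (runs_writePairs r₃ h₃).mono le_rfl fun A hA => ⟨y, f, hf, ?_⟩
  rw [hy]
  rw [hA₃ 13 (by decide), e 0 (by decide), e 2 (by decide), e 12 (by decide), e 13 (by decide),
    e 14 (by decide), r₁.eval_param] at hA
  simpa [Expr.eval] using hA

theorem runs_reduceInstance (hx : x.IsSplit) (h : Ready x m.arr)
    (h4 : ∀ v : Fin x.n, m.arr 4 v = x.occ v)
    (hzero : ∀ a ∈ [8, 9, 10, 14, 15], m.arr a 0 = 0)
    (hhigh : x.numHigh (4 * x.k) ≤ 4 * x.k) :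
    Runs reduceInstance m (reduceTime x.n x.k) fun A =>
      ∃ y, HasWritten A y.encode ∧ IsKernel x y := by
  have hsq : Nat.sqrt x.k ≤ x.k := Nat.sqrt_le_self x.k
  refine Runs.seq (runs_computeSqrt h (hzero 8 (by decide)) (hzero 9 (by decide)))
    fun m₁ h₁ hA₁ _ => ?_
  have r₁ := h.congr (hA₁ 0 (by decide)) (hA₁ 2 (by decide))
  refine Runs.seq ((runs_computeNumLayers r₁ h₁
    (by rw [hA₁ 10 (by decide), hzero 10 (by decide)])).mono (by gcongr) fun _ h => h)
    fun m₂ h₂ hA₂ _ => ?_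
  have r₂ := r₁.congr (hA₂ 0 (by decide)) (hA₂ 2 (by decide))
  refine Runs.seq ((runs_computeLayers r₂ h₂ (layersState_zero fun v => by
    rw [hA₂ 4 (by decide), hA₁ 4 (by decide), h4 v])).mono (by gcongr) fun _ h => h)
    fun m₃ h₃ hA₃ _ => ?_
  have r₃ := r₂.congr (hA₃ 0 (by decide)) (hA₃ 2 (by decide))
  refine Runs.seq (runs_numberVertices r₃ (by
    rw [hA₃ 14 (by decide), hA₂ 14 (by decide), hA₁ 14 (by decide), hzero 14 (by decide)]))
    fun m₄ h₄ hA₄ _ => ?_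
  have r₄ := r₃.congr (hA₄ 0 (by decide)) (hA₄ 2 (by decide))
  obtain ⟨L, -, hT, -⟩ := id h₃
  refine (runs_writeInduced r₄ (by
    rw [hA₄ 15 (by decide), hA₃ 15 (by decide), hA₂ 15 (by decide), hA₁ 15 (by decide),
      hzero 15 (by decide)]) h₄ hT).mono le_rfl ?_
  rintro A ⟨y, f, hf, hw⟩
  exact ⟨y, hw, isKernel_of_layersState hx hhigh h₃ hf⟩

/-- The running time of `kernelize`. -/
def kernelTime (n k : ℕ) : ℕ :=
  (n * 3 + 3) + ((n * (n * 3 + 4) + 2) + ((k * 4 + 2) + ((n * 4 + 2) + ((n * 4 + 2) +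
    (23 + reduceTime n k + 1)))))

theorem runs_kernelize (hx : x.IsSplit) :
    Runs kernelize (inputMemory x.encode) (kernelTime x.n x.k) fun A =>
      ∃ y, HasWritten A y.encode ∧ IsKernel x y := by
  have hin : IsInput x ((inputMemory x.encode).arr 0) := by
    simpa [inputMemory] using isInput_encode x
  have hzero : ∀ a i, a ≠ 0 → (inputMemory x.encode).arr a i = 0 := by
    intro a i ha
    simp [inputMemory, ha]
  refine Runs.seq (runs_computeRows hin) fun m₁ r₁ hA₁ _ => ?_
  refine Runs.seq (runs_computeDegrees r₁ fun v => by
    rw [hA₁ 3 (by decide), hzero 3 _ (by decide)]) fun m₂ h₂ hA₂ _ => ?_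
  have r₂ := r₁.congr (hA₂ 0 (by decide)) (hA₂ 2 (by decide))
  refine Runs.seq (runs_computeOccurrences r₂ fun v => by
    rw [hA₂ 4 (by decide), hA₁ 4 (by decide), hzero 4 _ (by decide)]) fun m₃ h₃ hA₃ _ => ?_
  have r₃ := r₂.congr (hA₃ 0 (by decide)) (hA₃ 2 (by decide))
  have d₃ : ∀ v : Fin x.n, m₃.arr 3 v = x.deg v := fun v => by
    rw [hA₃ 3 (by decide), h₂]
  refine Runs.seq (runs_countHigh r₃ d₃ (by
    rw [hA₃ 5 (by decide), hA₂ 5 (by decide), hA₁ 5 (by decide), hzero 5 _ (by decide)]))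
    fun m₄ h₄ hA₄ _ => ?_
  have r₄ := r₃.congr (hA₄ 0 (by decide)) (hA₄ 2 (by decide))
  have d₄ : ∀ v : Fin x.n, m₄.arr 3 v = x.deg v := fun v => by
    rw [hA₄ 3 (by decide), d₃]
  have o₄ : ∀ v : Fin x.n, m₄.arr 4 v = x.occ v := fun v => by
    rw [hA₄ 4 (by decide), h₃]
  refine Runs.seq (runs_checkDegrees r₄ d₄ o₄ (by
    rw [hA₄ 6 (by decide), hA₃ 6 (by decide), hA₂ 6 (by decide), hA₁ 6 (by decide),
      hzero 6 _ (by decide)])) fun m₅ h₅ hA₅ _ => ?_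
  have r₅ := r₄.congr (hA₅ 0 (by decide)) (hA₅ 2 (by decide))
  have hz₅ : ∀ a ∈ [8, 9, 10, 14, 15], m₅.arr a 0 = 0 := by
    intro a ha
    have : a ∉ [0, 2, 3, 4, 5, 6] := by
      revert a
      decide
    simp only [List.mem_cons, List.not_mem_nil, or_false, not_or] at this
    rw [hA₅ a (by simpa [checkDegrees, Program.arrs, Program.forLoop] using this.2.2.2.2.2),
      hA₄ a (by simpa [countHigh, Program.arrs, Program.forLoop] using this.2.2.2.2.1),
      hA₃ a (by simpa [computeOccurrences, Program.arrs, Program.forLoop] using this.2.2.2.1),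
      hA₂ a (by simpa [computeDegrees, Program.arrs, Program.forLoop] using this.2.2.1),
      hA₁ a (by simpa [computeRows, Program.arrs, Program.forLoop] using this.2.1),
      hzero a 0 this.1]
  have h5₅ : m₅.arr 5 0 = x.numHigh (4 * x.k) := by rw [hA₅ 5 (by decide), h₄]
  have o₅ : ∀ v : Fin x.n, m₅.arr 4 v = x.occ v := fun v => by
    rw [hA₅ 4 (by decide), o₄]
  refine Runs.ite (fun he => ?_) fun he => ?_
  · simp only [Expr.eval, Expr.eval_times, r₅.eval_param, h5₅] at he
    exact (runs_decideInstance hx r₅ (hz₅ 15 (by decide)) (by omega) h₅).mono (by omega)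
      fun _ h => h
  · simp only [Expr.eval, Expr.eval_times, r₅.eval_param, h5₅] at he
    exact (runs_reduceInstance hx r₅ o₅ hz₅ (by omega)).mono (by omega) fun _ h => h

theorem length_encode (x : Instance) : x.encode.length = 2 + x.n * x.n + 2 * x.k := by
  simp [Instance.encode, Instance.k, List.length_flatMap]
  ring

theorem kernelTime_le {n k N : ℕ} (hn : n ≤ N) (hk : k ≤ N) : kernelTime n k ≤ kernelTime N N := by
  unfold kernelTime reduceTime layerTime
  gcongr

end

open Polynomial in
theorem exists_polynomial_kernelTime : ∃ P : Polynomial ℕ, ∀ N, P.eval N = kernelTime N N := by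
  refine ⟨(X * 3 + 3) + ((X * (X * 3 + 4) + 2) + ((X * 4 + 2) + ((X * 4 + 2) + ((X * 4 + 2) +
    (23 + (((X + 1) * 5 + 2) + (((X + 1) * 3 + 2) + ((10 * X * (X + 1) *
      ((X * 3 + 2 + (X * (X * (X * (X * 4 + 10) + 4) + 5) + 2)) + 2) + 2) +
    ((X * 6 + 2) + (2 + (2 + ((X * (X * 4 + 4) + 2) + (X * 6 + 2)))))))) + 1))))), fun N => ?_⟩
  simp [kernelTime, reduceTime, layerTime]

theorem vertex_bound (k : ℕ) : ((2 + 6 * k + 40 * k * k * (Nat.sqrt k + 1) : ℕ) : ℝ) ≤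
    88 * (max (k : ℝ) 1) ^ (2.75 : ℝ) := by
  rcases Nat.eq_zero_or_pos k with rfl | hk
  · norm_num
  · have hk1 : (1 : ℝ) ≤ k := by exact_mod_cast hk
    rw [max_eq_left hk1]
    have hsqrt : ((Nat.sqrt k : ℕ) : ℝ) ≤ (k : ℝ) ^ (0.5 : ℝ) := by
      have h : ((Nat.sqrt k : ℕ) : ℝ) ≤ √(k : ℝ) := Real.nat_sqrt_le_real_sqrt
      rwa [Real.sqrt_eq_rpow, show (1 / 2 : ℝ) = 0.5 by norm_num] at h
    have h1 : (1 : ℝ) ≤ (k : ℝ) ^ (0.5 : ℝ) := Real.one_le_rpow hk1 (by norm_num)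
    have h2 : (k : ℝ) * k * (k : ℝ) ^ (0.5 : ℝ) = (k : ℝ) ^ (2.5 : ℝ) := by
      rw [show (2.5 : ℝ) = 1 + 1 + 0.5 by norm_num, Real.rpow_add (by positivity),
        Real.rpow_add (by positivity), Real.rpow_one]
    have h3 : (k : ℝ) ^ (2.5 : ℝ) ≤ (k : ℝ) ^ (2.75 : ℝ) :=
      Real.rpow_le_rpow_of_exponent_le hk1 (by norm_num)
    have h4 : (k : ℝ) ≤ (k : ℝ) ^ (2.75 : ℝ) := by
      conv_lhs => rw [← Real.rpow_one (k : ℝ)]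
      exact Real.rpow_le_rpow_of_exponent_le hk1 (by norm_num)
    have h5 : (k : ℝ) * k * ((Nat.sqrt k : ℝ) + 1) ≤ k * k * (2 * (k : ℝ) ^ (0.5 : ℝ)) := by
      gcongr
      linarith
    push_cast
    nlinarith

end EDP

theorem theorem2 :
    ∃ (p : EDP.Program) (C : ℝ),
      EDP.IsSplitKernelization p (fun k : ℕ => C * (max (k : ℝ) 1) ^ (2.75 : ℝ)) := by
  obtain ⟨P, hP⟩ := EDP.exists_polynomial_kernelTime
  refine ⟨EDP.kernelize, 88, P, fun x hx => ?_⟩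
  obtain ⟨m, t, hexec, ht, y, hy, hker⟩ := EDP.runs_kernelize hx
  have hlen := EDP.length_encode x
  refine ⟨y, ⟨m, t, hexec, ?_, hy.2⟩, hker.isSplit, hker.connected, hker.isYes_iff, hker.k_le,
    (Nat.cast_le.2 hker.n_le).trans (EDP.vertex_bound x.k)⟩
  rw [hP]
  exact ht.trans (EDP.kernelTime_le (by nlinarith) (by omega))
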